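/- **Setting.** Let $\gamma>1$ and $0<r_1<r_s<r_2<\infty$. Consider a cylindrically symmetric transonic shock solution (the *background solution*) of the steady Euler system for a polytropic gas $P=K\rho^\gamma$ with sound speed $c^2=\gamma K\rho^{\gamma-1}$ and Bernoulli quantity $B=\frac12|\mathbf u|^2+\frac{\gamma}{\gamma-1}\frac{P}{\rho}$. That is, there are constants $0<\bar K^-<\bar K^+$ and smooth positive functions $\bar\rho^-,\bar U^-$ on $[r_1,r_s]$ and $\bar\rho^+,\bar U^+$ on $[r_s,r_2]$ satisfying $$(\bar\rho\bar U)'+\tfrac1r\bar\rho\bar U=0,\qquad \bar U\bar U'+\tfrac1{\bar\rho}\bar P'=0$$ on their intervals. The upstream flow is supersonic, $(\bar U^-)^2>c^2(\bar\rho^-,\bar K^-)$ on $[r_1,r_s]$. The downstream flow is subsonic, $(\bar U^+)^2<c^2(\bar\rho^+,\bar K^+)$ on $[r_s,r_2]$. At $r=r_s$ the Rankine–Hugoniot conditions $[\bar\rho\bar U]=[\bar\rho\bar U^2+\bar P]=[\bar B]=0$ hold, where $[g]=g(r_s+)-g(r_s-)$. Write $\bar\rho,\bar U,\bar K,\bar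 B$ for the downstream quantities ($\bar B$ is constant), $\bar c^2=c^2(\bar\rho,\bar K)$ and $\bar M^2=\bar U^2/\bar c^2$. Put $$a_0=\frac{(\bar\rho\bar U)(r_s)}{[\bar P(r_s)]},\quad a_1=\frac{\gamma\bar U(r_s)[\bar P(r_s)]}{r_s\bar\rho(r_s)(\bar c^2(r_s)-\bar U^2(r_s))},\quad a_2=\frac{(\gamma-1)[\bar P(r_s)]}{r_s\bar\rho(r_s)^\gamma},$$ $$a_3=\frac{(\gamma-1)\bar M^2(r_s)+1}{\gamma\bar M^2(r_s)},\quad a_4=a_0a_1a_3,$$ $$d_1=1-\bar M^2,\quad d_2(y_1)=\frac{\bar M^2(2+(\gamma-1)\bar M^2)}{y_1(1-\bar M^2)},\quad d_3=\frac{a_2}{a_1}\,\frac{\bar B-\frac12\bar U^2}{\gamma\bar K\bar U},$$ $$d_4=d_1d_3'+\Big(\frac1{y_1}+d_2\Big)d_3,\quad d_5=\frac1{y_1}+d_2-d_1'.$$ For $\theta_0\in(0,\frac\pi2)$ let $E=(-\theta_0,\theta_0)\times(-1,1)$ and $\mathbb D=(r_s,r_2)\times E$, with points $y=(y_1,y')$,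 $y'=(y_2,y_3)$. For $\phi\in H^1(\mathbb D)$ let $\phi(r_s,\cdot)$ and $\phi(r_2,\cdot)$ in $L^2(E)$ be its traces. For $K>0$, $G_5\in L^2(\mathbb D)$ and $m_1,m_2\in L^2(E)$ consider the problem $$\begin{cases} \partial_{y_1}(d_1\partial_{y_1}\phi)+\frac1{y_1^2}\partial_{y_2}^2\phi+\partial_{y_3}^2\phi+d_5\,\partial_{y_1}\phi-a_0a_1d_4\,\phi(r_s,y')-K\phi=G_5 & \text{in }\mathbb D,\\ \partial_{y_1}\phi(r_s,y')-a_4\phi(r_s,y')=m_1(y'),\qquad \partial_{y_1}\phi(r_2,y')=m_2(y') & \text{for } y'\in E,\\ \partial_{y_2}\phi(y_1,\pm\theta_0,y_3)=0,\qquad \partial_{y_3}\phi(y_1,y_2,\pm1)=0. \end{cases}$$ A *weak solution* is a function $\phi\in H^1(\mathbb D)$ such that, for all $\psi\in H^1(\mathbb D)$, $$\begin{aligned} &\iiint_{\mathbb D}\Big(d_1\partial_{y_1}\phi\,\partial_{y_1}\psi+\tfrac1{y_1^2}\partial_{y_2}\phi\,\partial_{y_2}\psi+\partial_{y_3}\phi\,\partial_{y_3}\psi-d_5\,\partial_{y_1}\phi\,\psi+a_0a_1d_4\,\phi(r_s,y')\psi\Big)dy\\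 &\quad+\iint_E d_1(r_s)a_4\,\phi(r_s,y')\psi(r_s,y')\,dy'+K\iiint_{\mathbb D}\phi\psi\,dy\\ &=-\iiint_{\mathbb D}\psi G_5\,dy+\iint_E\big(d_1(r_2)m_2(y')\psi(r_2,y')-d_1(r_s)m_1(y')\psi(r_s,y')\big)dy'. \end{aligned}$$ **Lemma.** For every background solution there is a constant $K_0>0$, depending only on the background solution (and not on $\theta_0,G_5,m_1,m_2$), such that for every $K\ge K_0$, every $\theta_0\in(0,\frac\pi2)$, and all $G_5\in L^2(\mathbb D)$ and $m_1,m_2\in L^2(E)$, the problem has a unique weak solution $\phi\in H^1(\mathbb D)$. -/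

import Mathlib

open MeasureTheory Set
open scoped ContDiff

noncomputable section

/-! ### Polytropic gas -/

/-- Pressure `P = k ρ ^ γ`, where `k` is the entropy function `A exp (S / c_v)`. -/
def gasPressure (γ k ρ : ℝ) : ℝ := k * ρ ^ γ

/-- Squared sound speed `c² = ∂P/∂ρ = γ k ρ ^ (γ - 1)`. -/
def soundSpeedSq (γ k ρ : ℝ) : ℝ := γ * k * ρ ^ (γ - 1)

/-- Bernoulli quantity `|u|² / 2 + e + P / ρ`, with `e = P / ((γ - 1) ρ)`. -/
def bernoulliQty (γ k ρ u : ℝ) : ℝ :=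
  u ^ 2 / 2 + gasPressure γ k ρ / ((γ - 1) * ρ) + gasPressure γ k ρ / ρ

/-- `(ρ, U)` is a smooth, purely radial, outgoing solution on `[a, b]` of the steady Euler system
in cylindrical coordinates with constant entropy function `k`: the continuity equation and the
radial momentum equation (the other equations hold trivially). -/
structure IsRadialEulerFlow (γ k a b : ℝ) (ρ U : ℝ → ℝ) : Prop where
  smooth_density : ContDiffOn ℝ ∞ ρ (Icc a b)
  smooth_velocity : ContDiffOn ℝ ∞ U (Icc a b)
  density_pos : ∀ r ∈ Icc a b, 0 < ρ r
  velocity_pos : ∀ r ∈ Icc a b, 0 < U r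
  continuity : ∀ r ∈ Ioo a b, deriv (fun s => ρ s * U s) r + ρ r * U r / r = 0
  momentum : ∀ r ∈ Ioo a b,
    U r * deriv U r + deriv (fun s => gasPressure γ k (ρ s)) r / ρ r = 0

/-- A cylindrically symmetric transonic shock (the background solution): a supersonic flow
`(ρm, Um, km)` on `[r1, rs]` and a subsonic flow `(ρp, Up, kp)` on `[rs, r2]`, linked at `r = rs`
by the Rankine–Hugoniot conditions and the entropy condition. -/
structure TransonicShock where
  /-- adiabatic exponent -/
  γ : ℝ
  /-- radius of the inlet -/
  r1 : ℝ
  /-- radius of the shock -/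
  rs : ℝ
  /-- radius of the exit -/
  r2 : ℝ
  /-- upstream entropy function -/
  km : ℝ
  /-- downstream entropy function -/
  kp : ℝ
  /-- upstream density -/
  ρm : ℝ → ℝ
  /-- upstream velocity -/
  Um : ℝ → ℝ
  /-- downstream density -/
  ρp : ℝ → ℝ
  /-- downstream velocity -/
  Up : ℝ → ℝ
  one_lt_γ : 1 < γ
  r1_pos : 0 < r1
  r1_lt_rs : r1 < rs
  rs_lt_r2 : rs < r2
  km_pos : 0 < km
  upstream : IsRadialEulerFlow γ km r1 rs ρm Um
  downstream : IsRadialEulerFlow γ kp rs r2 ρp Up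
  supersonic : ∀ r ∈ Icc r1 rs, soundSpeedSq γ km (ρm r) < Um r ^ 2
  subsonic : ∀ r ∈ Icc rs r2, Up r ^ 2 < soundSpeedSq γ kp (ρp r)
  jump_mass : ρp rs * Up rs = ρm rs * Um rs
  jump_momentum : ρp rs * Up rs ^ 2 + gasPressure γ kp (ρp rs)
    = ρm rs * Um rs ^ 2 + gasPressure γ km (ρm rs)
  jump_bernoulli : bernoulliQty γ kp (ρp rs) (Up rs) = bernoulliQty γ km (ρm rs) (Um rs)
  entropy : km < kp

namespace TransonicShock

variable (S : TransonicShock)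

/-- Jump of the pressure at the shock. -/
def jumpP : ℝ := gasPressure S.γ S.kp (S.ρp S.rs) - gasPressure S.γ S.km (S.ρm S.rs)

/-- The (constant) Bernoulli quantity of the downstream flow. -/
def Bbar : ℝ := bernoulliQty S.γ S.kp (S.ρp S.rs) (S.Up S.rs)

/-- Squared Mach number of the downstream flow. -/
def machSq (r : ℝ) : ℝ := S.Up r ^ 2 / soundSpeedSq S.γ S.kp (S.ρp r)

def a0 : ℝ := S.ρp S.rs * S.Up S.rs / S.jumpP

def a1 : ℝ := S.γ * S.Up S.rs * S.jumpP /
  (S.rs * S.ρp S.rs * (soundSpeedSq S.γ S.kp (S.ρp S.rs) - S.Up S.rs ^ 2))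

def a2 : ℝ := (S.γ - 1) * S.jumpP / (S.rs * S.ρp S.rs ^ S.γ)

def a3 : ℝ := ((S.γ - 1) * S.machSq S.rs + 1) / (S.γ * S.machSq S.rs)

def a4 : ℝ := S.a0 * S.a1 * S.a3

def d1 (r : ℝ) : ℝ := 1 - S.machSq r

def d2 (r : ℝ) : ℝ :=
  S.machSq r * (2 + (S.γ - 1) * S.machSq r) / (r * (1 - S.machSq r))

def d3 (r : ℝ) : ℝ := S.a2 / S.a1 * ((S.Bbar - S.Up r ^ 2 / 2) / (S.γ * S.kp * S.Up r))

def d4 (r : ℝ) : ℝ := S.d1 r * deriv S.d3 r + (1 / r + S.d2 r) * S.d3 r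

def d5 (r : ℝ) : ℝ := 1 / r + S.d2 r - deriv S.d1 r

end TransonicShock

/-! ### The Sobolev space `H¹` of a box, and traces on its two end faces -/

/-- The cross section `E = (-θ, θ) × (-1, 1)`. -/
def crossSection (θ : ℝ) : Set (ℝ × ℝ) := Ioo (-θ) θ ×ˢ Ioo (-1) 1

/-- The box `(a, b) × E`, with points `y = (y₁, y')`. -/
def box (a b θ : ℝ) : Set (ℝ × ℝ × ℝ) := Ioo a b ×ˢ crossSection θ

/-- `L²` of the box (Lebesgue measure). -/
abbrev BoxL2 (a b θ : ℝ) := Lp ℝ 2 ((volume : Measure (ℝ × ℝ × ℝ)).restrict (box a b θ))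

/-- `L²` of the cross section (Lebesgue measure). -/
abbrev SectionL2 (θ : ℝ) := Lp ℝ 2 ((volume : Measure (ℝ × ℝ)).restrict (crossSection θ))

/-- The coordinate directions of `y₁`, `y₂`, `y₃`. -/
def coordDir : Fin 3 → ℝ × ℝ × ℝ := ![(1, 0, 0), (0, 1, 0), (0, 0, 1)]

section Sobolev

variable {a b θ : ℝ}

/-- `g` is the weak `i`-th partial derivative of `u` in the box. -/
def IsWeakPartial (i : Fin 3) (u g : BoxL2 a b θ) : Prop :=
  ∀ η : ℝ × ℝ × ℝ → ℝ, ContDiff ℝ ∞ η → HasCompactSupport η → tsupport η ⊆ box a b θ →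
    ∫ y in box a b θ, u y * fderiv ℝ η y (coordDir i) = -∫ y in box a b θ, g y * η y

/-- `u ∈ H¹`: all first weak partial derivatives exist and are in `L²`. -/
def MemH1 (u : BoxL2 a b θ) : Prop := ∀ i : Fin 3, ∃ g : BoxL2 a b θ, IsWeakPartial i u g

open Classical in
/-- The weak `i`-th partial derivative of `u` (zero if there is none in `L²`). -/
def weakPartial (i : Fin 3) (u : BoxL2 a b θ) : BoxL2 a b θ :=
  if h : ∃ g : BoxL2 a b θ, IsWeakPartial i u g then h.choose else 0

/-- `τ = (τ.1, τ.2)` are the traces of `u ∈ H¹` on the end faces `y₁ = a` and `y₁ = b`, in the sense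
of the Gauss–Green formula for the vector fields `ψ e₁`, with `ψ` smooth up to the boundary. -/
def IsTracePair (u : BoxL2 a b θ) (τ : SectionL2 θ × SectionL2 θ) : Prop :=
  ∀ ψ : ℝ × ℝ × ℝ → ℝ, ContDiff ℝ ∞ ψ → HasCompactSupport ψ →
    ∫ y in box a b θ, (u y * fderiv ℝ ψ y (coordDir 0) + weakPartial 0 u y * ψ y)
      = (∫ y' in crossSection θ, τ.2 y' * ψ (b, y'))
        - ∫ y' in crossSection θ, τ.1 y' * ψ (a, y')

open Classical in
/-- The traces of `u` on the faces `y₁ = a` and `y₁ = b`; every `u ∈ H¹` has exactly one pair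
of traces (outside `H¹` the value may be meaningless). -/
def tracePair (u : BoxL2 a b θ) : SectionL2 θ × SectionL2 θ :=
  if h : ∃ τ : SectionL2 θ × SectionL2 θ, IsTracePair u τ then h.choose else 0

/-- The trace `u(a, ·)`. -/
def traceLeft (u : BoxL2 a b θ) : SectionL2 θ := (tracePair u).1

/-- The trace `u(b, ·)`. -/
def traceRight (u : BoxL2 a b θ) : SectionL2 θ := (tracePair u).2

end Sobolev

/-! ### The weak formulation -/

namespace TransonicShock

variable (S : TransonicShock)

/-- The bilinear form of the oblique boundary value problem with the nonlocal term
`a₀ a₁ d₄ φ(rs, y')`. -/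
def bilin {θ : ℝ} (φ ψ : BoxL2 S.rs S.r2 θ) : ℝ :=
  (∫ y in box S.rs S.r2 θ,
      (S.d1 y.1 * weakPartial 0 φ y * weakPartial 0 ψ y
        + 1 / y.1 ^ 2 * weakPartial 1 φ y * weakPartial 1 ψ y
        + weakPartial 2 φ y * weakPartial 2 ψ y
        - S.d5 y.1 * weakPartial 0 φ y * ψ y
        + S.a0 * S.a1 * S.d4 y.1 * traceLeft φ y.2 * ψ y))
    + ∫ y' in crossSection θ, S.d1 S.rs * S.a4 * traceLeft φ y' * traceLeft ψ y'

/-- The linear form given by the interior datum `G` and the boundary data `m₁`, `m₂`. -/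
def linForm {θ : ℝ} (G : ℝ × ℝ × ℝ → ℝ) (m₁ m₂ : ℝ × ℝ → ℝ) (ψ : BoxL2 S.rs S.r2 θ) : ℝ :=
  -(∫ y in box S.rs S.r2 θ, ψ y * G y)
    + ∫ y' in crossSection θ,
        (S.d1 S.r2 * m₂ y' * traceRight ψ y' - S.d1 S.rs * m₁ y' * traceLeft ψ y')

/-- `φ` is a weak `H¹` solution of the problem shifted by `-K φ`:
`∂₁(d₁ ∂₁φ) + y₁⁻² ∂₂²φ + ∂₃²φ + d₅ ∂₁φ - a₀ a₁ d₄ φ(rs, y') - K φ = G` in the box,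
`∂₁φ - a₄ φ = m₁` at `y₁ = rs`, `∂₁φ = m₂` at `y₁ = r2`, and homogeneous Neumann conditions on the
lateral faces. -/
def IsWeakSolution {θ : ℝ} (K : ℝ) (G : ℝ × ℝ × ℝ → ℝ) (m₁ m₂ : ℝ × ℝ → ℝ)
    (φ : BoxL2 S.rs S.r2 θ) : Prop :=
  MemH1 φ ∧ ∀ ψ : BoxL2 S.rs S.r2 θ, MemH1 ψ →
    S.bilin φ ψ + K * (∫ y in box S.rs S.r2 θ, φ y * ψ y) = S.linForm G m₁ m₂ ψ

end TransonicShock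

end

noncomputable section

/-! ### Operators on real `L²` spaces -/

section L2Tools

variable {α : Type*} [MeasurableSpace α] {μ : Measure α}

/-! The proof is Lax–Milgram on `H¹`. Subsonicity makes `d1` positive on the compact interval, hence
bounded below by some `δ > 0`, so the principal part controls all first derivatives. The other terms
(first-order drift, nonlocal term, Robin term) may have any sign. Young's inequality and a trace
inequality `‖φ(rs,·)‖² ≤ C‖φ‖² + ε‖∂₁φ‖²` bound them by a fraction of `δ‖∂₁φ‖²` plus a multiple of
`‖φ‖²`, and the shift `K` absorbs that multiple (`coercive_lower_bound`).

Traces are defined only through a Gauss–Green formula, so their existence and bounds must be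
derived. For smooth `α` with `α(a) = 1`, `α(b) = 0`, the left trace is `-∫ (α' u + α ∂₁u) dy₁`
(`IsWeakPartial.isTracePair`). To see this, subtract from a test function the `α`-interpolation of
its end values; the remainder vanishes on both end faces, where
`IsWeakPartial.integral_mul_fderiv_of_vanish` applies. Taking `α` concentrated near `a` makes the
coefficient of `∂₁u` small (`exists_trace_bound`). All these constants come from one-dimensional
integrals in `y₁`, which is why `K₀` does not depend on `θ₀`.

`H¹` is realised as a closed subspace of `(L²)⁴`, so completeness is immediate and the weak
formulation becomes an identity between bounded forms (`existsUnique_weakSolution`). -/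

theorem inner_L2_eq_integral (f g : Lp ℝ 2 μ) : inner ℝ f g = ∫ x, f x * g x ∂μ := by
  rw [L2.inner_def]
  exact integral_congr_ae (Filter.Eventually.of_forall fun x => by simp [mul_comm])

theorem norm_sq_L2_eq_integral (f : Lp ℝ 2 μ) : ‖f‖ ^ 2 = ∫ x, f x ^ 2 ∂μ := by
  rw [← real_inner_self_eq_norm_sq, inner_L2_eq_integral]
  simp only [sq]

theorem integrable_L2_mul (f g : Lp ℝ 2 μ) : Integrable (fun x => f x * g x) μ :=
  (Lp.memLp f).integrable_mul (Lp.memLp g)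

theorem inner_L2_eq_of_ae {f g : Lp ℝ 2 μ} {F G : α → ℝ} (hf : f =ᵐ[μ] F) (hg : g =ᵐ[μ] G) :
    inner ℝ f g = ∫ x, F x * G x ∂μ := by
  rw [inner_L2_eq_integral]
  refine integral_congr_ae ?_
  filter_upwards [hf, hg] with x h1 h2
  rw [h1, h2]

theorem memLp_bdd_mul {m f : α → ℝ} {C : ℝ} (hm : AEStronglyMeasurable m μ)
    (hb : ∀ᵐ x ∂μ, |m x| ≤ C) (hf : MemLp f 2 μ) : MemLp (fun x => m x * f x) 2 μ := by
  refine hf.of_le_mul (hm.mul hf.1) (c := C) ?_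
  filter_upwards [hb] with x hx
  rw [norm_mul, Real.norm_eq_abs]
  gcongr

/-- Multiplication by an essentially bounded function is a bounded operator on `L²`. -/
theorem exists_mulL2 {m : α → ℝ} {C : ℝ} (hm : AEStronglyMeasurable m μ)
    (hb : ∀ᵐ x ∂μ, |m x| ≤ C) :
    ∃ M : Lp ℝ 2 μ →L[ℝ] Lp ℝ 2 μ, (∀ f, M f =ᵐ[μ] fun x => m x * f x) ∧
      ∀ f, ‖M f‖ ≤ C * ‖f‖ := by
  have hmem (f : Lp ℝ 2 μ) := memLp_bdd_mul hm hb (Lp.memLp f)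
  let M₀ : Lp ℝ 2 μ →ₗ[ℝ] Lp ℝ 2 μ :=
    { toFun := fun f => (hmem f).toLp
      map_add' := fun f g => by
        apply Lp.ext
        filter_upwards [(hmem (f + g)).coeFn_toLp, (hmem f).coeFn_toLp, (hmem g).coeFn_toLp,
          Lp.coeFn_add f g, Lp.coeFn_add (hmem f).toLp (hmem g).toLp] with x h1 h2 h3 h4 h5
        rw [h1, h5, Pi.add_apply, h2, h3, h4, Pi.add_apply, mul_add]
      map_smul' := fun c f => by
        apply Lp.ext
        filter_upwards [(hmem (c • f)).coeFn_toLp, (hmem f).coeFn_toLp,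
          Lp.coeFn_smul c f, Lp.coeFn_smul c (hmem f).toLp] with x h1 h2 h3 h4
        simp only [RingHom.id_apply]
        rw [h1, h4, Pi.smul_apply, h2, h3, Pi.smul_apply, smul_eq_mul, smul_eq_mul]
        ring }
  have hbound : ∀ f, ‖M₀ f‖ ≤ C * ‖f‖ := fun f => by
    apply Lp.norm_le_mul_norm_of_ae_le_mul
    filter_upwards [(hmem f).coeFn_toLp, hb] with x h1 h2
    change ‖((hmem f).toLp _ : Lp ℝ 2 μ) x‖ ≤ _
    rw [h1, norm_mul, Real.norm_eq_abs]
    gcongr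
  exact ⟨M₀.mkContinuous C hbound, fun f => (hmem f).coeFn_toLp, hbound⟩

theorem le_inner_of_ae_le {m : α → ℝ} {δ : ℝ} {f g : Lp ℝ 2 μ} (hg : g =ᵐ[μ] fun x => m x * f x)
    (hm : ∀ᵐ x ∂μ, δ ≤ m x) : δ * ‖f‖ ^ 2 ≤ inner ℝ g f := by
  rw [inner_L2_eq_integral, norm_sq_L2_eq_integral, ← integral_const_mul]
  refine integral_mono_ae (((Lp.memLp f).integrable_sq).const_mul δ) (integrable_L2_mul g f) ?_
  filter_upwards [hg, hm] with x h1 h2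
  rw [h1]
  nlinarith [sq_nonneg (f x)]

end L2Tools

/-! ### Tensor products with a fixed `L²` function. -/

section Tensor

variable {α β : Type*} [MeasurableSpace α] [MeasurableSpace β] {μ : Measure α} {ν : Measure β}

theorem memLp_tensor {w : α → ℝ} {f : β → ℝ} (hw : MemLp w 2 μ) (hf : MemLp f 2 ν) :
    MemLp (fun z : α × β => w z.1 * f z.2) 2 (μ.prod ν) := by
  refine (memLp_two_iff_integrable_sq (hw.1.comp_fst.mul hf.1.comp_snd)).2 ?_
  simpa only [Pi.mul_apply, mul_pow] using hw.integrable_sq.mul_prod hf.integrable_sq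

/-- For a fixed `w ∈ L²(μ)`, the operator `f ↦ w ⊗ f` from `L²(ν)` to `L²(μ ⊗ ν)`. -/
theorem exists_tensorL2 [SFinite μ] [SFinite ν] {w : α → ℝ} (hw : MemLp w 2 μ) :
    ∃ T : Lp ℝ 2 ν →L[ℝ] Lp ℝ 2 (μ.prod ν),
      (∀ f, T f =ᵐ[μ.prod ν] fun z => w z.1 * f z.2) ∧
      ∀ f, ‖T f‖ ≤ Real.sqrt (∫ x, w x ^ 2 ∂μ) * ‖f‖ := by
  have hmem (f : Lp ℝ 2 ν) := memLp_tensor hw (Lp.memLp f)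
  let T₀ : Lp ℝ 2 ν →ₗ[ℝ] Lp ℝ 2 (μ.prod ν) :=
    { toFun := fun f => (hmem f).toLp
      map_add' := fun f g => by
        apply Lp.ext
        filter_upwards [(hmem (f + g)).coeFn_toLp, (hmem f).coeFn_toLp, (hmem g).coeFn_toLp,
          Measure.quasiMeasurePreserving_snd.ae (Lp.coeFn_add f g),
          Lp.coeFn_add (hmem f).toLp (hmem g).toLp] with x h1 h2 h3 h4 h5
        rw [h1, h5, Pi.add_apply, h2, h3, h4, Pi.add_apply, mul_add]
      map_smul' := fun c f => by
        apply Lp.ext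
        filter_upwards [(hmem (c • f)).coeFn_toLp, (hmem f).coeFn_toLp,
          Measure.quasiMeasurePreserving_snd.ae (Lp.coeFn_smul c f),
          Lp.coeFn_smul c (hmem f).toLp] with x h1 h2 h3 h4
        simp only [RingHom.id_apply]
        rw [h1, h4, Pi.smul_apply, h2, h3, Pi.smul_apply, smul_eq_mul, smul_eq_mul]
        ring }
  have hbound : ∀ f, ‖T₀ f‖ ≤ Real.sqrt (∫ x, w x ^ 2 ∂μ) * ‖f‖ := fun f => by
    -- By Fubini the squared norm factorises exactly.
    have h : ‖T₀ f‖ ^ 2 = (∫ x, w x ^ 2 ∂μ) * ‖f‖ ^ 2 := by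
      rw [norm_sq_L2_eq_integral, norm_sq_L2_eq_integral, ← integral_prod_mul]
      refine integral_congr_ae ?_
      filter_upwards [(hmem f).coeFn_toLp] with x hx
      change ((hmem f).toLp _ : Lp ℝ 2 (μ.prod ν)) x ^ 2 = _
      rw [hx, mul_pow]
    have h0 : 0 ≤ ∫ x, w x ^ 2 ∂μ := integral_nonneg fun x => sq_nonneg _
    refine le_of_sq_le_sq ?_ (by positivity)
    rw [h, mul_pow, Real.sq_sqrt h0]
  exact ⟨T₀.mkContinuous _ hbound, fun f => (hmem f).coeFn_toLp, hbound⟩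

end Tensor

/-! ### Extension from the cross section and weighted slice integrals. -/

section BoxTensor

variable {a b θ : ℝ}

theorem restrict_box_eq_prod : (volume : Measure (ℝ × ℝ × ℝ)).restrict (box a b θ)
    = ((volume : Measure ℝ).restrict (Ioo a b)).prod
        ((volume : Measure (ℝ × ℝ)).restrict (crossSection θ)) := by
  rw [Measure.prod_restrict]
  rfl

/-- The operator `τ ↦ w(y₁) τ(y')` from `L²` of the cross section to `L²` of the box. -/
theorem exists_extend {w : ℝ → ℝ} (hw : MemLp w 2 (volume.restrict (Ioo a b))) :
    ∃ T : SectionL2 θ →L[ℝ] BoxL2 a b θ,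
      (∀ f, T f =ᵐ[volume.restrict (box a b θ)] fun y => w y.1 * f y.2) ∧
      ∀ f, ‖T f‖ ≤ Real.sqrt (∫ s in Ioo a b, w s ^ 2) * ‖f‖ := by
  unfold BoxL2
  rw [restrict_box_eq_prod]
  exact exists_tensorL2 hw

/-- The operator `τ ↦ w(y₁) τ(y')` from `L²` of the cross section to `L²` of the box. -/
def extend (θ : ℝ) {w : ℝ → ℝ} (hw : MemLp w 2 (volume.restrict (Ioo a b))) :
    SectionL2 θ →L[ℝ] BoxL2 a b θ := (exists_extend hw).choose

theorem extend_ae {w : ℝ → ℝ} (hw : MemLp w 2 (volume.restrict (Ioo a b))) (f : SectionL2 θ) :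
    extend θ hw f =ᵐ[volume.restrict (box a b θ)] fun y => w y.1 * f y.2 :=
  (exists_extend hw).choose_spec.1 f

theorem norm_extend_le {w : ℝ → ℝ} (hw : MemLp w 2 (volume.restrict (Ioo a b))) :
    ‖extend θ hw‖ ≤ Real.sqrt (∫ s in Ioo a b, w s ^ 2) :=
  ContinuousLinearMap.opNorm_le_bound _ (Real.sqrt_nonneg _) (exists_extend hw).choose_spec.2

/-- The weighted slice integral `u ↦ ∫ w(s) u(s, y') ds`, as the adjoint of `extend`. -/
def slice (θ : ℝ) {w : ℝ → ℝ} (hw : MemLp w 2 (volume.restrict (Ioo a b))) :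
    BoxL2 a b θ →L[ℝ] SectionL2 θ := ContinuousLinearMap.adjoint (extend θ hw)

/-- An adjoint has the norm of the original operator. The bound involves only the weight in `y₁`,
which makes the trace estimates uniform in `θ`. -/
theorem norm_slice_le {w : ℝ → ℝ} (hw : MemLp w 2 (volume.restrict (Ioo a b))) :
    ‖slice θ hw‖ ≤ Real.sqrt (∫ s in Ioo a b, w s ^ 2) := by
  rw [slice, LinearIsometryEquiv.norm_map]
  exact norm_extend_le hw

theorem ae_snd_of_ae {p : ℝ × ℝ → Prop} (h : ∀ᵐ z ∂volume.restrict (crossSection θ), p z) :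
    ∀ᵐ y : ℝ × ℝ × ℝ ∂volume.restrict (box a b θ), p y.2 := by
  rw [restrict_box_eq_prod]
  exact Measure.quasiMeasurePreserving_snd.ae h

theorem aestronglyMeasurable_comp_fst_box {w : ℝ → ℝ}
    (h : AEStronglyMeasurable w (volume.restrict (Ioo a b))) :
    AEStronglyMeasurable (fun y : ℝ × ℝ × ℝ => w y.1) (volume.restrict (box a b θ)) := by
  rw [restrict_box_eq_prod]
  exact h.comp_fst

theorem integral_slice_mul {w : ℝ → ℝ} (hw : MemLp w 2 (volume.restrict (Ioo a b)))
    (u : BoxL2 a b θ) {f : ℝ × ℝ → ℝ} (hf : MemLp f 2 (volume.restrict (crossSection θ))) :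
    ∫ z in crossSection θ, slice θ hw u z * f z = ∫ y in box a b θ, u y * (w y.1 * f y.2) := by
  have h1 := inner_L2_eq_of_ae (Filter.EventuallyEq.refl _ (slice θ hw u : ℝ × ℝ → ℝ))
    hf.coeFn_toLp
  have h2 : (extend θ hw hf.toLp : ℝ × ℝ × ℝ → ℝ) =ᵐ[volume.restrict (box a b θ)]
      fun y => w y.1 * f y.2 := by
    filter_upwards [extend_ae hw hf.toLp, ae_snd_of_ae (a := a) (b := b) hf.coeFn_toLp]
      with y h3 h4
    rw [h3, h4]
  rw [← h1, slice, ContinuousLinearMap.adjoint_inner_left,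
    inner_L2_eq_of_ae (Filter.EventuallyEq.refl _ (u : ℝ × ℝ × ℝ → ℝ)) h2]

end BoxTensor

/-! ### Cutoff functions exhausting an interval -/

section Cutoff

open Filter Topology

/-- A smooth step: `0` for `x ≤ 1` and `1` for `x ≥ 2`. -/
def smoothStep (x : ℝ) : ℝ := Real.smoothTransition (x - 1)

theorem contDiff_smoothStep : ContDiff ℝ ∞ smoothStep :=
  Real.smoothTransition.contDiff.comp (contDiff_id.sub contDiff_const)

theorem smoothStep_nonneg (x : ℝ) : 0 ≤ smoothStep x := Real.smoothTransition.nonneg _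

theorem smoothStep_le_one (x : ℝ) : smoothStep x ≤ 1 := Real.smoothTransition.le_one _

theorem smoothStep_eq_zero {x : ℝ} (hx : x ≤ 1) : smoothStep x = 0 :=
  Real.smoothTransition.zero_of_nonpos (by linarith)

theorem smoothStep_eq_one {x : ℝ} (hx : 2 ≤ x) : smoothStep x = 1 :=
  Real.smoothTransition.one_of_one_le (by linarith)

theorem deriv_smoothStep_eq_zero {x : ℝ} (hx : x < 1 ∨ 2 < x) : deriv smoothStep x = 0 := by
  rcases hx with hx | hx
  · have : smoothStep =ᶠ[𝓝 x] fun _ => 0 := by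
      filter_upwards [Iio_mem_nhds hx] with t ht using smoothStep_eq_zero (le_of_lt ht)
    rw [this.deriv_eq, deriv_const]
  · have : smoothStep =ᶠ[𝓝 x] fun _ => 1 := by
      filter_upwards [Ioi_mem_nhds hx] with t ht using smoothStep_eq_one (le_of_lt ht)
    rw [this.deriv_eq, deriv_const]

/-- The derivative lives on `[1, 2]`. The product with `x` is the scale-invariant quantity: at `x =
n d` its bound does not depend on `n`. -/
theorem exists_bound_mul_deriv_smoothStep : ∃ C, 0 ≤ C ∧ ∀ x, |x * deriv smoothStep x| ≤ C := by
  have hc : Continuous fun x => x * deriv smoothStep x :=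
    continuous_id.mul (contDiff_smoothStep.continuous_deriv (by simp))
  have hs : HasCompactSupport fun x => x * deriv smoothStep x := by
    refine HasCompactSupport.intro (isCompact_Icc (a := (1 : ℝ)) (b := 2)) fun x hx => ?_
    rw [deriv_smoothStep_eq_zero, mul_zero]
    by_contra! h
    exact hx h
  obtain ⟨C, hC⟩ := hs.exists_bound_of_continuous hc
  exact ⟨C, (norm_nonneg _).trans (hC 0), hC⟩

/-- The cutoff `s ↦ F(n(s - a)) F(n(b - s))` of the interval `(a, b)`. -/
def intervalCutoff (a b : ℝ) (n : ℕ) (s : ℝ) : ℝ :=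
  smoothStep ((n : ℝ) * (s - a)) * smoothStep ((n : ℝ) * (b - s))

variable {a b : ℝ}

theorem contDiff_intervalCutoff (n : ℕ) : ContDiff ℝ ∞ (intervalCutoff a b n) :=
  (contDiff_smoothStep.comp (contDiff_const.mul (contDiff_id.sub contDiff_const))).mul
    (contDiff_smoothStep.comp (contDiff_const.mul (contDiff_const.sub contDiff_id)))

theorem intervalCutoff_nonneg (n : ℕ) (s : ℝ) : 0 ≤ intervalCutoff a b n s :=
  mul_nonneg (smoothStep_nonneg _) (smoothStep_nonneg _)

theorem intervalCutoff_le_one (n : ℕ) (s : ℝ) : intervalCutoff a b n s ≤ 1 :=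
  mul_le_one₀ (smoothStep_le_one _) (smoothStep_nonneg _) (smoothStep_le_one _)

theorem intervalCutoff_eq_zero {n : ℕ} (hn : 0 < n) {s : ℝ}
    (hs : s ∉ Icc (a + 1 / n) (b - 1 / n)) : intervalCutoff a b n s = 0 := by
  have hn' : (0 : ℝ) < n := by exact_mod_cast hn
  rw [mem_Icc, not_and_or, not_le, not_le] at hs
  rcases hs with h | h
  · have : (n : ℝ) * (s - a) ≤ 1 := by
      rw [← mul_one_div_cancel hn'.ne']
      gcongr
      linarith
    rw [intervalCutoff, smoothStep_eq_zero this, zero_mul]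
  · have : (n : ℝ) * (b - s) ≤ 1 := by
      rw [← mul_one_div_cancel hn'.ne']
      gcongr
      linarith
    rw [intervalCutoff, smoothStep_eq_zero this, mul_zero]

theorem deriv_intervalCutoff (n : ℕ) (s : ℝ) : deriv (intervalCutoff a b n) s =
    n * deriv smoothStep (n * (s - a)) * smoothStep (n * (b - s))
      - n * smoothStep (n * (s - a)) * deriv smoothStep (n * (b - s)) := by
  have hF (x : ℝ) : HasDerivAt smoothStep (deriv smoothStep x) x :=
    (contDiff_smoothStep.differentiable (by simp) x).hasDerivAt
  have h1 : HasDerivAt (fun s : ℝ => (n : ℝ) * (s - a)) n s := by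
    simpa using ((hasDerivAt_id s).sub_const a).const_mul (n : ℝ)
  have h2 : HasDerivAt (fun s : ℝ => (n : ℝ) * (b - s)) (-n) s := by
    simpa using ((hasDerivAt_id s).const_sub b).const_mul (n : ℝ)
  have h := ((hF _).comp s h1).mul ((hF _).comp s h2)
  refine h.deriv.trans ?_
  simp only [Function.comp]
  ring

/-- The cutoff's derivative has size `n`, but only at distance of order `1/n` from an endpoint. A
quantity vanishing linearly at both ends compensates for it, uniformly in `n`. -/
theorem exists_bound_deriv_intervalCutoff_mul : ∃ C, 0 ≤ C ∧ ∀ (a b : ℝ) (n : ℕ) (L s x : ℝ),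
    s ∈ Ioo a b → |x| ≤ L * (s - a) → |x| ≤ L * (b - s) →
      |deriv (intervalCutoff a b n) s * x| ≤ C * L := by
  obtain ⟨C, hC0, hC⟩ := exists_bound_mul_deriv_smoothStep
  -- One contribution `C` from each endpoint.
  refine ⟨2 * C, by positivity, fun a b n L s x hs h1 h2 => ?_⟩
  have hsa : 0 < s - a := sub_pos.2 hs.1
  have hbs : 0 < b - s := sub_pos.2 hs.2
  have hL : 0 ≤ L := nonneg_of_mul_nonneg_left ((abs_nonneg x).trans h1) hsa
  have key (d : ℝ) (hd : 0 < d) (hx : |x| ≤ L * d) (q : ℝ) (hq0 : 0 ≤ q) (hq1 : q ≤ 1) :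
      |n * deriv smoothStep (n * d) * q * x| ≤ C * L := by
    have h3 := hC (n * d)
    rw [abs_mul, abs_of_nonneg (by positivity : 0 ≤ n * d)] at h3
    rw [abs_mul, abs_mul, abs_mul, abs_of_nonneg (Nat.cast_nonneg n), abs_of_nonneg hq0]
    calc n * |deriv smoothStep (n * d)| * q * |x|
        ≤ n * |deriv smoothStep (n * d)| * 1 * (L * d) := by gcongr
      _ = (n * d * |deriv smoothStep (n * d)|) * L := by ring
      _ ≤ C * L := by gcongr
  have k1 := key (s - a) hsa h1 _ (smoothStep_nonneg (n * (b - s))) (smoothStep_le_one _)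
  have k2 := key (b - s) hbs h2 _ (smoothStep_nonneg (n * (s - a))) (smoothStep_le_one _)
  rw [deriv_intervalCutoff, sub_mul]
  refine (abs_sub _ _).trans ?_
  rw [show (n : ℝ) * smoothStep (n * (s - a)) * deriv smoothStep (n * (b - s)) * x
    = n * deriv smoothStep (n * (b - s)) * smoothStep (n * (s - a)) * x by ring]
  linarith

theorem eventually_two_lt_nat_mul {d : ℝ} (hd : 0 < d) : ∀ᶠ n : ℕ in atTop, 2 < n * d :=
  (tendsto_natCast_atTop_atTop.atTop_mul_const hd).eventually_gt_atTop 2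

theorem eventually_intervalCutoff_eq_one {s : ℝ} (hs : s ∈ Ioo a b) :
    ∀ᶠ n : ℕ in atTop, intervalCutoff a b n s = 1 ∧ deriv (intervalCutoff a b n) s = 0 := by
  filter_upwards [eventually_two_lt_nat_mul (sub_pos.2 hs.1),
    eventually_two_lt_nat_mul (sub_pos.2 hs.2)] with n h1 h2
  rw [deriv_intervalCutoff, intervalCutoff, smoothStep_eq_one h1.le, smoothStep_eq_one h2.le,
    deriv_smoothStep_eq_zero (Or.inr h1), deriv_smoothStep_eq_zero (Or.inr h2)]
  simp

end Cutoff

/-! ### Integration by parts in the box -/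

section ByParts

open Filter Topology

variable {a b θ : ℝ}

theorem isOpen_crossSection : IsOpen (crossSection θ) := isOpen_Ioo.prod isOpen_Ioo

theorem isOpen_box : IsOpen (box a b θ) := isOpen_Ioo.prod isOpen_crossSection

/-- The closed box. -/
def closedBox (a b θ : ℝ) : Set (ℝ × ℝ × ℝ) := Icc a b ×ˢ (Icc (-θ) θ ×ˢ Icc (-1) 1)

theorem isCompact_closedBox : IsCompact (closedBox a b θ) :=
  isCompact_Icc.prod (isCompact_Icc.prod isCompact_Icc)

theorem box_subset_closedBox : box a b θ ⊆ closedBox a b θ :=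
  Set.prod_mono Ioo_subset_Icc_self (Set.prod_mono Ioo_subset_Icc_self Ioo_subset_Icc_self)

instance isFiniteMeasure_box :
    IsFiniteMeasure ((volume : Measure (ℝ × ℝ × ℝ)).restrict (box a b θ)) :=
  ⟨by
    rw [Measure.restrict_apply_univ]
    exact (measure_mono box_subset_closedBox).trans_lt isCompact_closedBox.measure_lt_top⟩

instance isFiniteMeasure_crossSection :
    IsFiniteMeasure ((volume : Measure (ℝ × ℝ)).restrict (crossSection θ)) :=
  ⟨by
    rw [Measure.restrict_apply_univ]
    exact (measure_mono (Set.prod_mono Ioo_subset_Icc_self Ioo_subset_Icc_self)).trans_lt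
      (isCompact_Icc.prod isCompact_Icc).measure_lt_top⟩

theorem memLp_box_of_continuous {f : ℝ × ℝ × ℝ → ℝ} (hf : Continuous f) :
    MemLp f 2 (volume.restrict (box a b θ)) := by
  obtain ⟨C, hC⟩ := isCompact_closedBox.exists_bound_of_continuousOn
    (hf.continuousOn (s := closedBox a b θ))
  refine MemLp.of_bound hf.aestronglyMeasurable C ?_
  filter_upwards [ae_restrict_mem isOpen_box.measurableSet] with y hy
  exact hC y (box_subset_closedBox hy)

theorem memLp_crossSection_of_continuous {f : ℝ × ℝ → ℝ} (hf : Continuous f) :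
    MemLp f 2 (volume.restrict (crossSection θ)) := by
  obtain ⟨C, hC⟩ := (isCompact_Icc.prod isCompact_Icc).exists_bound_of_continuousOn
    (hf.continuousOn (s := Icc (-θ) θ ×ˢ Icc (-1) 1))
  refine MemLp.of_bound hf.aestronglyMeasurable C ?_
  filter_upwards [ae_restrict_mem isOpen_crossSection.measurableSet] with y hy
  exact hC y (Set.prod_mono Ioo_subset_Icc_self Ioo_subset_Icc_self hy)

theorem memLp_Ioo_of_continuous {f : ℝ → ℝ} (hf : Continuous f) :
    MemLp f 2 (volume.restrict (Ioo a b)) := by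
  obtain ⟨C, hC⟩ := isCompact_Icc.exists_bound_of_continuousOn
    (hf.continuousOn (s := Icc a b))
  refine MemLp.of_bound hf.aestronglyMeasurable C ?_
  filter_upwards [ae_restrict_mem measurableSet_Ioo] with y hy
  exact hC y (Ioo_subset_Icc_self hy)

theorem integrable_L2_mul_continuous (u : BoxL2 a b θ) {f : ℝ × ℝ × ℝ → ℝ} (hf : Continuous f) :
    Integrable (fun y => u y * f y) (volume.restrict (box a b θ)) :=
  (Lp.memLp u).integrable_mul (memLp_box_of_continuous hf)

theorem hasDerivAt_slice {f : ℝ × ℝ × ℝ → ℝ} (hf : ContDiff ℝ ∞ f) (s : ℝ) (z : ℝ × ℝ) :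
    HasDerivAt (fun t => f (t, z)) (fderiv ℝ f (s, z) (coordDir 0)) s := by
  have h1 := (hf.differentiable (by simp) (s, z)).hasFDerivAt
  have h2 : HasDerivAt (fun t : ℝ => (t, z)) ((1, 0) : ℝ × ℝ × ℝ) s :=
    (hasDerivAt_id s).prodMk (hasDerivAt_const s z)
  exact h1.comp_hasDerivAt s h2

theorem fderiv_coordDir_zero_eq {f : ℝ × ℝ × ℝ → ℝ} (hf : ContDiff ℝ ∞ f) {y : ℝ × ℝ × ℝ} {d : ℝ}
    (h : HasDerivAt (fun t => f (t, y.2)) d y.1) : fderiv ℝ f y (coordDir 0) = d :=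
  (hasDerivAt_slice hf y.1 y.2).unique h

theorem continuous_fderiv_coordDir {f : ℝ × ℝ × ℝ → ℝ} (hf : ContDiff ℝ ∞ f) (i : Fin 3) :
    Continuous fun y => fderiv ℝ f y (coordDir i) :=
  (hf.continuous_fderiv (by simp)).clm_apply continuous_const

/-- The product cutoff of the box. -/
def boxCutoff (a b θ : ℝ) (n : ℕ) (y : ℝ × ℝ × ℝ) : ℝ :=
  intervalCutoff a b n y.1 * (intervalCutoff (-θ) θ n y.2.1 * intervalCutoff (-1) 1 n y.2.2)

theorem contDiff_boxCutoff (n : ℕ) : ContDiff ℝ ∞ (boxCutoff a b θ n) :=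
  ((contDiff_intervalCutoff n).comp contDiff_fst).mul
    (((contDiff_intervalCutoff n).comp (contDiff_fst.comp contDiff_snd)).mul
      ((contDiff_intervalCutoff n).comp (contDiff_snd.comp contDiff_snd)))

theorem boxCutoff_tsupport {n : ℕ} (hn : 0 < n) : IsCompact (tsupport (boxCutoff a b θ n)) ∧
    tsupport (boxCutoff a b θ n) ⊆ box a b θ := by
  have hn' : (0 : ℝ) < 1 / n := by positivity
  have hK : IsCompact (Icc (a + 1 / n) (b - 1 / n) ×ˢ
      (Icc (-θ + 1 / n) (θ - 1 / n) ×ˢ Icc ((-1 : ℝ) + 1 / n) (1 - 1 / n) : Set (ℝ × ℝ))) :=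
    isCompact_Icc.prod (isCompact_Icc.prod isCompact_Icc)
  have hsub : tsupport (boxCutoff a b θ n) ⊆ Icc (a + 1 / n) (b - 1 / n) ×ˢ
      (Icc (-θ + 1 / n) (θ - 1 / n) ×ˢ Icc ((-1 : ℝ) + 1 / n) (1 - 1 / n) : Set (ℝ × ℝ)) := by
    refine closure_minimal (fun y hy => ?_) hK.isClosed
    rw [Function.mem_support, boxCutoff] at hy
    refine ⟨?_, ?_, ?_⟩ <;> by_contra h <;> exact hy (by simp [intervalCutoff_eq_zero hn h])
  have hIcc (c d : ℝ) : Icc (c + 1 / n) (d - 1 / n) ⊆ Ioo c d := fun x hx =>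
    ⟨by linarith [hx.1], by linarith [hx.2]⟩
  exact ⟨hK.of_isClosed_subset (isClosed_tsupport _) hsub,
    hsub.trans (Set.prod_mono (hIcc _ _) (Set.prod_mono (hIcc _ _) (hIcc _ _)))⟩

/-- The lateral cutoffs are constant in `y₁`, so only the end-face cutoff is differentiated. Its
derivative is grouped with `ψ` to match `exists_bound_deriv_intervalCutoff_mul`. -/
theorem fderiv_boxCutoff_mul {ψ : ℝ × ℝ × ℝ → ℝ} (hψ : ContDiff ℝ ∞ ψ) (n : ℕ) (y : ℝ × ℝ × ℝ) :
    fderiv ℝ (fun y => boxCutoff a b θ n y * ψ y) y (coordDir 0) =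
      intervalCutoff (-θ) θ n y.2.1 * intervalCutoff (-1) 1 n y.2.2 *
        (deriv (intervalCutoff a b n) y.1 * ψ y)
      + boxCutoff a b θ n y * fderiv ℝ ψ y (coordDir 0) := by
  refine fderiv_coordDir_zero_eq ((contDiff_boxCutoff n).mul hψ) ?_
  have h1 : HasDerivAt (intervalCutoff a b n) _ y.1 :=
    ((contDiff_intervalCutoff n).differentiable (by simp) y.1).hasDerivAt
  have h := (h1.mul_const (intervalCutoff (-θ) θ n y.2.1 * intervalCutoff (-1) 1 n y.2.2)).mul
    (hasDerivAt_slice hψ y.1 y.2)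
  refine HasDerivAt.congr_deriv h ?_
  simp only [boxCutoff, Prod.mk.eta]
  ring

theorem boxCutoff_nonneg (n : ℕ) (y : ℝ × ℝ × ℝ) : 0 ≤ boxCutoff a b θ n y :=
  mul_nonneg (intervalCutoff_nonneg _ _)
    (mul_nonneg (intervalCutoff_nonneg _ _) (intervalCutoff_nonneg _ _))

theorem boxCutoff_le_one (n : ℕ) (y : ℝ × ℝ × ℝ) : boxCutoff a b θ n y ≤ 1 :=
  mul_le_one₀ (intervalCutoff_le_one _ _)
    (mul_nonneg (intervalCutoff_nonneg _ _) (intervalCutoff_nonneg _ _))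
    (mul_le_one₀ (intervalCutoff_le_one _ _) (intervalCutoff_nonneg _ _)
      (intervalCutoff_le_one _ _))

/-- The integration by parts formula for a weak `y₁`-derivative extends to smooth test functions
that vanish on the two end faces only. -/
theorem IsWeakPartial.integral_mul_fderiv_of_vanish {u g : BoxL2 a b θ} (h : IsWeakPartial 0 u g)
    {ψ : ℝ × ℝ × ℝ → ℝ} (hψ : ContDiff ℝ ∞ ψ) (hψa : ∀ z, ψ (a, z) = 0)
    (hψb : ∀ z, ψ (b, z) = 0) :
    ∫ y in box a b θ, u y * fderiv ℝ ψ y (coordDir 0) = -∫ y in box a b θ, g y * ψ y := by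
  obtain ⟨L, hL⟩ := isCompact_closedBox.exists_bound_of_continuousOn
    ((continuous_fderiv_coordDir hψ 0).continuousOn (s := closedBox a b θ))
  obtain ⟨P, hP⟩ := isCompact_closedBox.exists_bound_of_continuousOn
    (hψ.continuous.continuousOn (s := closedBox a b θ))
  obtain ⟨C, hC0, hC⟩ := exists_bound_deriv_intervalCutoff_mul
  -- Vanishing on the end faces and the mean value inequality give linear decay there, which offsets
  -- the blow-up of the cutoff's derivative.
  have hmean : ∀ y ∈ box a b θ, |ψ y| ≤ L * (y.1 - a) ∧ |ψ y| ≤ L * (b - y.1) := by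
    rintro ⟨s, z⟩ ⟨hs, hz⟩
    have hz' := Set.prod_mono Ioo_subset_Icc_self Ioo_subset_Icc_self hz
    have hab : a ≤ b := (hs.1.trans hs.2).le
    have hd : ∀ t ∈ Icc a b, ‖deriv (fun t => ψ (t, z)) t‖ ≤ L := fun t ht => by
      rw [(hasDerivAt_slice hψ t z).deriv]
      exact hL (t, z) ⟨ht, hz'⟩
    have hdiff : ∀ t ∈ Icc a b, DifferentiableAt ℝ (fun t => ψ (t, z)) t := fun t _ =>
      (hasDerivAt_slice hψ t z).differentiableAt
    have h1 := (convex_Icc a b).norm_image_sub_le_of_norm_deriv_le hdiff hd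
      (left_mem_Icc.2 hab) (Ioo_subset_Icc_self hs)
    have h2 := (convex_Icc a b).norm_image_sub_le_of_norm_deriv_le hdiff hd
      (right_mem_Icc.2 hab) (Ioo_subset_Icc_self hs)
    simp only [hψa, hψb, sub_zero, Real.norm_eq_abs] at h1 h2
    rw [abs_of_pos (sub_pos.2 hs.1)] at h1
    rw [abs_sub_comm, abs_of_pos (sub_pos.2 hs.2)] at h2
    exact ⟨h1, h2⟩
  have hev : ∀ y ∈ box a b θ, ∀ᶠ n : ℕ in atTop,
      boxCutoff a b θ n y = 1 ∧ deriv (intervalCutoff a b n) y.1 = 0 := by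
    rintro y ⟨hy1, hy2, hy3⟩
    filter_upwards [eventually_intervalCutoff_eq_one hy1, eventually_intervalCutoff_eq_one hy2,
      eventually_intervalCutoff_eq_one hy3] with n h1 h2 h3
    simp [boxCutoff, h1, h2, h3]
  have hcd (n : ℕ) : ContDiff ℝ ∞ fun y => boxCutoff a b θ n y * ψ y :=
    (contDiff_boxCutoff n).mul hψ
  have hu : Integrable u (volume.restrict (box a b θ)) :=
    (Lp.memLp u).integrable (by norm_num)
  have hg : Integrable g (volume.restrict (box a b θ)) :=
    (Lp.memLp g).integrable (by norm_num)
  have lim1 : Tendsto (fun n : ℕ => ∫ y in box a b θ,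
      u y * fderiv ℝ (fun y => boxCutoff a b θ n y * ψ y) y (coordDir 0)) atTop
      (𝓝 (∫ y in box a b θ, u y * fderiv ℝ ψ y (coordDir 0))) := by
    -- `C * L` dominates the term with the differentiated cutoff, `L` the term with the
    -- differentiated `ψ`.
    refine tendsto_integral_of_dominated_convergence (fun y => ‖u y‖ * (C * L + L))
      (fun n => hu.1.mul (continuous_fderiv_coordDir (hcd n) 0).aestronglyMeasurable)
      (hu.norm.mul_const _) (fun n => ?_) ?_
    · filter_upwards [ae_restrict_mem isOpen_box.measurableSet] with y hy
      rw [norm_mul, fderiv_boxCutoff_mul hψ]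
      gcongr
      refine (norm_add_le _ _).trans (add_le_add ?_ ?_)
      · rw [norm_mul, Real.norm_eq_abs, Real.norm_eq_abs]
        have h1 := hC a b n L y.1 (ψ y) hy.1 (hmean y hy).1 (hmean y hy).2
        have h2 : |intervalCutoff (-θ) θ n y.2.1 * intervalCutoff (-1) 1 n y.2.2| ≤ 1 := by
          rw [abs_of_nonneg (mul_nonneg (intervalCutoff_nonneg _ _) (intervalCutoff_nonneg _ _))]
          exact mul_le_one₀ (intervalCutoff_le_one _ _) (intervalCutoff_nonneg _ _)
            (intervalCutoff_le_one _ _)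
        calc _ ≤ 1 * |deriv (intervalCutoff a b n) y.1 * ψ y| := by gcongr
          _ ≤ C * L := by rwa [one_mul]
      · rw [norm_mul, Real.norm_eq_abs, abs_of_nonneg (boxCutoff_nonneg _ _)]
        calc _ ≤ 1 * ‖fderiv ℝ ψ y (coordDir 0)‖ := by
              gcongr
              exact boxCutoff_le_one _ _
          _ ≤ L := by
              rw [one_mul]
              exact hL y (box_subset_closedBox hy)
    · filter_upwards [ae_restrict_mem isOpen_box.measurableSet] with y hy
      refine tendsto_const_nhds.congr' ?_
      filter_upwards [hev y hy] with n hn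
      rw [fderiv_boxCutoff_mul hψ, hn.1, hn.2]
      ring
  have lim2 : Tendsto (fun n : ℕ => ∫ y in box a b θ, g y * (boxCutoff a b θ n y * ψ y)) atTop
      (𝓝 (∫ y in box a b θ, g y * ψ y)) := by
    refine tendsto_integral_of_dominated_convergence (fun y => ‖g y‖ * P)
      (fun n => hg.1.mul (hcd n).continuous.aestronglyMeasurable)
      (hg.norm.mul_const _) (fun n => ?_) ?_
    · filter_upwards [ae_restrict_mem isOpen_box.measurableSet] with y hy
      rw [norm_mul]
      gcongr
      rw [norm_mul, Real.norm_eq_abs, abs_of_nonneg (boxCutoff_nonneg _ _)]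
      calc _ ≤ 1 * ‖ψ y‖ := by
            gcongr
            exact boxCutoff_le_one _ _
        _ ≤ P := by
            rw [one_mul]
            exact hP y (box_subset_closedBox hy)
    · filter_upwards [ae_restrict_mem isOpen_box.measurableSet] with y hy
      refine tendsto_const_nhds.congr' ?_
      filter_upwards [hev y hy] with n hn
      rw [hn.1, one_mul]
  refine tendsto_nhds_unique lim1 (lim2.neg.congr' ?_)
  -- For `n > 0` the cut-off function is an admissible test function, so the defining identity holds
  -- before the limit.
  filter_upwards [eventually_gt_atTop 0] with n hn
  have hsub : tsupport (fun y => boxCutoff a b θ n y * ψ y) ⊆ tsupport (boxCutoff a b θ n) :=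
    tsupport_mul_subset_left
  exact (h _ (hcd n) ((boxCutoff_tsupport hn).1.of_isClosed_subset (isClosed_tsupport _) hsub)
    (hsub.trans (boxCutoff_tsupport hn).2)).symm

end ByParts

/-! ### Uniqueness of weak derivatives and existence of traces -/

section Traces

variable {a b θ : ℝ}

/-- The fundamental lemma of the calculus of variations; finiteness of the measure puts `L²` inside
`L¹`. -/
theorem L2_eq_of_integral_mul_test_eq {E : Type*} [NormedAddCommGroup E] [NormedSpace ℝ E]
    [FiniteDimensional ℝ E] [MeasurableSpace E] [BorelSpace E] {μ : Measure E} {U : Set E}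
    [IsFiniteMeasure (μ.restrict U)] (hU : IsOpen U) {f g : Lp ℝ 2 (μ.restrict U)}
    (h : ∀ η : E → ℝ, ContDiff ℝ ∞ η → HasCompactSupport η → tsupport η ⊆ U →
      ∫ y in U, f y * η y ∂μ = ∫ y in U, g y * η y ∂μ) : f = g := by
  have hf : Integrable f (μ.restrict U) := (Lp.memLp f).integrable (by norm_num)
  have hg : Integrable g (μ.restrict U) := (Lp.memLp g).integrable (by norm_num)
  have key := hU.ae_eq_zero_of_integral_contDiff_smul_eq_zero (f := fun y => f y - g y)
    ((hf.sub hg).locallyIntegrable.locallyIntegrableOn U) fun η h1 h2 h3 => by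
      obtain ⟨C, hC⟩ := h2.exists_bound_of_continuous h1.continuous
      have hint {k : E → ℝ} (hk : Integrable k (μ.restrict U)) :
          Integrable (fun y => k y * η y) (μ.restrict U) :=
        hk.mul_bdd h1.continuous.aestronglyMeasurable (Filter.Eventually.of_forall hC)
      calc ∫ y in U, η y • (f y - g y) ∂μ
          = ∫ y in U, (f y * η y - g y * η y) ∂μ := by
            congr 1 with y
            rw [smul_eq_mul]
            ring
        _ = 0 := by rw [integral_sub (hint hf) (hint hg), h η h1 h2 h3, sub_self]
  apply Lp.ext
  filter_upwards [key, ae_restrict_mem hU.measurableSet] with y h1 h2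
  exact sub_eq_zero.1 (h1 h2)

theorem IsWeakPartial.unique {i : Fin 3} {u g g' : BoxL2 a b θ} (h : IsWeakPartial i u g)
    (h' : IsWeakPartial i u g') : g = g' :=
  L2_eq_of_integral_mul_test_eq isOpen_box fun η h1 h2 h3 =>
    neg_injective ((h η h1 h2 h3).symm.trans (h' η h1 h2 h3))

/-- Uniqueness identifies the derivative picked by choice with any given one. -/
theorem IsWeakPartial.weakPartial_eq {i : Fin 3} {u g : BoxL2 a b θ} (h : IsWeakPartial i u g) :
    weakPartial i u = g := by
  have hex : ∃ g : BoxL2 a b θ, IsWeakPartial i u g := ⟨g, h⟩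
  rw [weakPartial, dif_pos hex]
  exact hex.choose_spec.unique h

theorem exists_smooth_compact_one_zero {c d : ℝ} (hcd : c ≠ d) :
    ∃ χ : ℝ → ℝ, ContDiff ℝ ∞ χ ∧ HasCompactSupport χ ∧ χ c = 1 ∧ χ d = 0 := by
  have hd : 0 < dist d c := dist_pos.2 hcd.symm
  -- The outer radius is exactly the distance to `d`, so the bump already vanishes there.
  let f : ContDiffBump c := ⟨dist d c / 2, dist d c, by linarith, by linarith⟩
  exact ⟨f, f.contDiff, f.hasCompactSupport,
    f.one_of_mem_closedBall (Metric.mem_closedBall_self f.rIn_pos.le), f.zero_of_le_dist le_rfl⟩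

theorem hasCompactSupport_tensor {χ : ℝ → ℝ} {η : ℝ × ℝ → ℝ} (hχ : HasCompactSupport χ)
    (hη : HasCompactSupport η) : HasCompactSupport fun y : ℝ × ℝ × ℝ => χ y.1 * η y.2 := by
  refine HasCompactSupport.intro (hχ.isCompact.prod hη.isCompact) fun y hy => ?_
  rw [Set.mem_prod, not_and_or] at hy
  rcases hy with h | h
  · rw [image_eq_zero_of_notMem_tsupport h, zero_mul]
  · rw [image_eq_zero_of_notMem_tsupport h, mul_zero]

/-- The volume side of Gauss–Green does not involve the traces. Tests `χ(y₁) η(y')` with `χ` equal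
to `1` at one end and `0` at the other isolate a single face. -/
theorem IsTracePair.unique (hab : a < b) {u : BoxL2 a b θ} {τ τ' : SectionL2 θ × SectionL2 θ}
    (h : IsTracePair u τ) (h' : IsTracePair u τ') : τ = τ' := by
  have key (χ : ℝ → ℝ) (hχ : ContDiff ℝ ∞ χ) (hχ' : HasCompactSupport χ) (η : ℝ × ℝ → ℝ)
      (hη : ContDiff ℝ ∞ η) (hη' : HasCompactSupport η) :=
    (h (fun y => χ y.1 * η y.2) ((hχ.comp contDiff_fst).mul (hη.comp contDiff_snd))
      (hasCompactSupport_tensor hχ' hη')).symm.trans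
    (h' (fun y => χ y.1 * η y.2) ((hχ.comp contDiff_fst).mul (hη.comp contDiff_snd))
      (hasCompactSupport_tensor hχ' hη'))
  refine Prod.ext ?_ ?_
  · obtain ⟨χ, h1, h2, h3, h4⟩ := exists_smooth_compact_one_zero hab.ne
    refine L2_eq_of_integral_mul_test_eq isOpen_crossSection fun η h5 h6 _ => ?_
    have := key χ h1 h2 η h5 h6
    simpa [h3, h4] using this
  · obtain ⟨χ, h1, h2, h3, h4⟩ := exists_smooth_compact_one_zero hab.ne'
    refine L2_eq_of_integral_mul_test_eq isOpen_crossSection fun η h5 h6 _ => ?_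
    have := key χ h1 h2 η h5 h6
    simpa [h3, h4] using this

theorem IsTracePair.tracePair_eq (hab : a < b) {u : BoxL2 a b θ}
    {τ : SectionL2 θ × SectionL2 θ} (h : IsTracePair u τ) : tracePair u = τ := by
  have hex : ∃ τ : SectionL2 θ × SectionL2 θ, IsTracePair u τ := ⟨τ, h⟩
  rw [tracePair, dif_pos hex]
  exact hex.choose_spec.unique hab h

theorem inner_slice_toLp {w : ℝ → ℝ} (hw : MemLp w 2 (volume.restrict (Ioo a b)))
    (u : BoxL2 a b θ) {f : ℝ × ℝ → ℝ} (hf : MemLp f 2 (volume.restrict (crossSection θ))) :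
    inner ℝ (slice θ hw u) hf.toLp = ∫ y in box a b θ, u y * (w y.1 * f y.2) := by
  rw [inner_L2_eq_of_ae (Filter.EventuallyEq.refl _ _) hf.coeFn_toLp,
    integral_slice_mul hw u hf]

/-- Traces are weighted slice integrals, for any smooth weight `α` with `α(a) = 1`,
`α(b) = 0`. -/
theorem IsWeakPartial.isTracePair {u g : BoxL2 a b θ} (h : IsWeakPartial 0 u g) {α : ℝ → ℝ}
    (hα : ContDiff ℝ ∞ α) (hαa : α a = 1) (hαb : α b = 0)
    (h₀ : MemLp (deriv α) 2 (volume.restrict (Ioo a b)))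
    (h₁ : MemLp α 2 (volume.restrict (Ioo a b)))
    (h₂ : MemLp (fun s => 1 - α s) 2 (volume.restrict (Ioo a b))) :
    IsTracePair u (-(slice θ h₀ u + slice θ h₁ g), slice θ h₂ g - slice θ h₀ u) := by
  intro ψ hψ _
  have hψc (c : ℝ) : ContDiff ℝ ∞ fun z : ℝ × ℝ => ψ (c, z) :=
    hψ.comp (contDiff_const.prodMk contDiff_id)
  have hα' : Continuous (deriv α) := hα.continuous_deriv (by simp)
  have hL (c : ℝ) : MemLp (fun z : ℝ × ℝ => ψ (c, z)) 2 (volume.restrict (crossSection θ)) :=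
    memLp_crossSection_of_continuous (hψc c).continuous
  have hpair (τ : SectionL2 θ) (c : ℝ) :
      ∫ z in crossSection θ, τ z * ψ (c, z) = inner ℝ τ (hL c).toLp :=
    (inner_L2_eq_of_ae (Filter.EventuallyEq.refl _ _) (hL c).coeFn_toLp).symm
  -- Subtracting the `α`-interpolation of the two end values leaves a function that vanishes on both
  -- end faces. The interpolation itself contributes exactly the slice integrals.
  let ψ₀ : ℝ × ℝ × ℝ → ℝ := fun y =>
    ψ y - (α y.1 * ψ (a, y.2) + (1 - α y.1) * ψ (b, y.2))
  have hψ₀ : ContDiff ℝ ∞ ψ₀ :=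
    hψ.sub (((hα.comp contDiff_fst).mul ((hψc a).comp contDiff_snd)).add
      ((contDiff_const.sub (hα.comp contDiff_fst)).mul ((hψc b).comp contDiff_snd)))
  have hd (y : ℝ × ℝ × ℝ) : fderiv ℝ ψ₀ y (coordDir 0) =
      fderiv ℝ ψ y (coordDir 0) - (deriv α y.1 * ψ (a, y.2) - deriv α y.1 * ψ (b, y.2)) := by
    refine fderiv_coordDir_zero_eq hψ₀ ?_
    have h3 : HasDerivAt α (deriv α y.1) y.1 := (hα.differentiable (by simp) y.1).hasDerivAt
    have h4 := (hasDerivAt_slice hψ y.1 y.2).sub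
      ((h3.mul_const (ψ (a, y.2))).add ((h3.const_sub 1).mul_const (ψ (b, y.2))))
    refine HasDerivAt.congr_deriv h4 ?_
    rw [neg_mul, ← sub_eq_add_neg]
  have hpart := h.integral_mul_fderiv_of_vanish hψ₀ (fun z => by simp [ψ₀, hαa])
    (fun z => by simp [ψ₀, hαb])
  have hi (v : BoxL2 a b θ) {f : ℝ × ℝ × ℝ → ℝ} (hf : Continuous f) :=
    integrable_L2_mul_continuous v hf
  have c1 := continuous_fderiv_coordDir hψ 0
  have c2 (c : ℝ) : Continuous fun y : ℝ × ℝ × ℝ => deriv α y.1 * ψ (c, y.2) :=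
    (hα'.comp continuous_fst).mul ((hψc c).continuous.comp continuous_snd)
  have c3 : Continuous fun y : ℝ × ℝ × ℝ => α y.1 * ψ (a, y.2) :=
    (hα.continuous.comp continuous_fst).mul ((hψc a).continuous.comp continuous_snd)
  have c4 : Continuous fun y : ℝ × ℝ × ℝ => (1 - α y.1) * ψ (b, y.2) :=
    (continuous_const.sub (hα.continuous.comp continuous_fst)).mul
      ((hψc b).continuous.comp continuous_snd)
  have e1 : ∫ y in box a b θ, u y * fderiv ℝ ψ₀ y (coordDir 0) =
      (∫ y in box a b θ, u y * fderiv ℝ ψ y (coordDir 0))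
        - ((∫ y in box a b θ, u y * (deriv α y.1 * ψ (a, y.2)))
          - ∫ y in box a b θ, u y * (deriv α y.1 * ψ (b, y.2))) := by
    rw [← integral_sub (hi u (c2 a)) (hi u (c2 b)),
      ← integral_sub (hi u c1)
        (show Integrable (fun y => u y * (deriv α y.1 * ψ (a, y.2))
          - u y * (deriv α y.1 * ψ (b, y.2))) _ from (hi u (c2 a)).sub (hi u (c2 b)))]
    congr 1 with y
    rw [hd]
    ring
  have e2 : ∫ y in box a b θ, g y * ψ₀ y = (∫ y in box a b θ, g y * ψ y)
        - ((∫ y in box a b θ, g y * (α y.1 * ψ (a, y.2)))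
          + ∫ y in box a b θ, g y * ((1 - α y.1) * ψ (b, y.2))) := by
    rw [← integral_add (hi g c3) (hi g c4),
      ← integral_sub (hi g hψ.continuous)
        (show Integrable (fun y => g y * (α y.1 * ψ (a, y.2))
          + g y * ((1 - α y.1) * ψ (b, y.2))) _ from (hi g c3).add (hi g c4))]
    congr 1 with y
    simp only [ψ₀]
    ring
  rw [h.weakPartial_eq, integral_add (hi u c1) (hi g hψ.continuous)]
  simp only [hpair, inner_neg_left, inner_add_left, inner_sub_left, inner_slice_toLp]
  linarith

theorem IsWeakPartial.trace_eq (hab : a < b) {u g : BoxL2 a b θ} (h : IsWeakPartial 0 u g)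
    {α : ℝ → ℝ} (hα : ContDiff ℝ ∞ α) (hαa : α a = 1) (hαb : α b = 0)
    (h₀ : MemLp (deriv α) 2 (volume.restrict (Ioo a b)))
    (h₁ : MemLp α 2 (volume.restrict (Ioo a b)))
    (h₂ : MemLp (fun s => 1 - α s) 2 (volume.restrict (Ioo a b))) :
    traceLeft u = -(slice θ h₀ u + slice θ h₁ g) ∧
      traceRight u = slice θ h₂ g - slice θ h₀ u := by
  rw [traceLeft, traceRight, (h.isTracePair hα hαa hαb h₀ h₁ h₂).tracePair_eq hab]
  exact ⟨rfl, rfl⟩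

/-- Both traces are given by bounded operators on pairs `(u, ∂₁u)`. -/
theorem exists_trace_operators (hab : a < b) (θ : ℝ) :
    ∃ L₀ L₁ R₀ R₁ : BoxL2 a b θ →L[ℝ] SectionL2 θ, ∀ u g : BoxL2 a b θ, IsWeakPartial 0 u g →
      traceLeft u = L₀ u + L₁ g ∧ traceRight u = R₀ u + R₁ g := by
  -- Any admissible weight serves here; the linear one is the simplest.
  have hα : ContDiff ℝ ∞ fun s : ℝ => (b - s) / (b - a) :=
    (contDiff_const.sub contDiff_id).div_const _
  have h₀ := memLp_Ioo_of_continuous (a := a) (b := b) (hα.continuous_deriv (by simp))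
  have h₁ := memLp_Ioo_of_continuous (a := a) (b := b) hα.continuous
  have h₂ := memLp_Ioo_of_continuous (a := a) (b := b)
    ((continuous_const (y := (1 : ℝ))).sub hα.continuous)
  refine ⟨-slice θ h₀, -slice θ h₁, -slice θ h₀, slice θ h₂, fun u g h => ?_⟩
  have := h.trace_eq hab hα (div_self (sub_pos.2 hab).ne') (by simp) h₀ h₁ h₂
  rw [this.1, this.2]
  simp only [neg_apply]
  exact ⟨neg_add _ _, by abel⟩

/-- The trace inequality with a small constant in front of the derivative. -/
theorem exists_trace_bound (hab : a < b) {ε : ℝ} (hε : 0 < ε) :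
    ∃ C, 0 ≤ C ∧ ∀ (θ : ℝ) (u g : BoxL2 a b θ), IsWeakPartial 0 u g →
      ‖traceLeft u‖ ^ 2 ≤ C * ‖u‖ ^ 2 + ε * ‖g‖ ^ 2 := by
  have hba : 0 < b - a := sub_pos.2 hab
  -- For the weight below, `∫ α² = (b - a) / (2n + 3)`, which this `n` pushes below `ε / 2`. The
  -- spare factor `2` pays for `(p + q)² ≤ 2p² + 2q²` at the end.
  obtain ⟨n, hn⟩ := exists_nat_gt ((b - a) / (ε / 2))
  let α : ℝ → ℝ := fun s => ((b - s) / (b - a)) ^ (n + 1)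
  have hα : ContDiff ℝ ∞ α := ((contDiff_const.sub contDiff_id).div_const _).pow _
  have h₀ := memLp_Ioo_of_continuous (a := a) (b := b) (hα.continuous_deriv (by simp))
  have h₁ := memLp_Ioo_of_continuous (a := a) (b := b) hα.continuous
  have h₂ := memLp_Ioo_of_continuous (a := a) (b := b)
    ((continuous_const (y := (1 : ℝ))).sub hα.continuous)
  have hsmall : ∫ s in Ioo a b, α s ^ 2 ≤ ε / 2 := by
    have hcalc : ∫ s in Ioo a b, α s ^ 2 = (b - a) / (2 * (n + 1) + 1) := by
      rw [← integral_Ioc_eq_integral_Ioo, ← intervalIntegral.integral_of_le hab.le]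
      have hsub := intervalIntegral.integral_comp_sub_left
        (fun x : ℝ => (x / (b - a)) ^ (2 * (n + 1))) (a := a) (b := b) b
      have : ∀ s, α s ^ 2 = ((b - s) / (b - a)) ^ (2 * (n + 1)) := fun s => by
        simp only [α, ← pow_mul, mul_comm]
      simp only [this]
      rw [hsub, sub_self, intervalIntegral.integral_comp_div (fun x : ℝ => x ^ (2 * (n + 1)))
        hba.ne', zero_div, div_self hba.ne', integral_pow]
      simp
      ring
    rw [hcalc, div_le_iff₀ (by positivity)]
    rw [div_lt_iff₀ (by positivity)] at hn
    nlinarith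
  refine ⟨2 * ∫ s in Ioo a b, deriv α s ^ 2,
    mul_nonneg zero_le_two (integral_nonneg fun s => sq_nonneg _), fun θ u g h => ?_⟩
  rw [(h.trace_eq hab hα (by simp [α, hba.ne']) (by simp [α]) h₀ h₁ h₂).1, norm_neg]
  have hA : 0 ≤ ∫ s in Ioo a b, deriv α s ^ 2 := integral_nonneg fun s => sq_nonneg _
  have hB : 0 ≤ ∫ s in Ioo a b, α s ^ 2 := integral_nonneg fun s => sq_nonneg _
  have n1 : ‖slice θ h₀ u‖ ^ 2 ≤ (∫ s in Ioo a b, deriv α s ^ 2) * ‖u‖ ^ 2 := by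
    rw [← Real.sq_sqrt hA, ← mul_pow]
    exact pow_le_pow_left₀ (norm_nonneg _) ((slice θ h₀).le_of_opNorm_le (norm_slice_le h₀) u) 2
  have n2 : ‖slice θ h₁ g‖ ^ 2 ≤ (∫ s in Ioo a b, α s ^ 2) * ‖g‖ ^ 2 := by
    rw [← Real.sq_sqrt hB, ← mul_pow]
    exact pow_le_pow_left₀ (norm_nonneg _) ((slice θ h₁).le_of_opNorm_le (norm_slice_le h₁) g) 2
  have n3 := mul_le_mul_of_nonneg_right hsmall (sq_nonneg ‖g‖)
  have n4 := pow_le_pow_left₀ (norm_nonneg _) (norm_add_le (slice θ h₀ u) (slice θ h₁ g)) 2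
  nlinarith [sq_nonneg (‖slice θ h₀ u‖ - ‖slice θ h₁ g‖)]

end Traces

/-! ### The Hilbert space `H¹` and the Lax–Milgram theorem -/

section LaxMilgram

variable {V : Type*} [NormedAddCommGroup V] [InnerProductSpace ℝ V]

/-- The real inner product as a continuous bilinear map. -/
def innerBilin (V : Type*) [NormedAddCommGroup V] [InnerProductSpace ℝ V] : V →L[ℝ] V →L[ℝ] ℝ :=
  (isBoundedBilinearMap_inner (𝕜 := ℝ) (E := V)).toContinuousLinearMap

/-- Coercivity makes the operator representing `B` invertible; it is applied to the Riesz
representative of `ℓ`. -/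
theorem IsCoercive.existsUnique_forall_eq [CompleteSpace V] {B : V →L[ℝ] V →L[ℝ] ℝ}
    (hB : IsCoercive B) (ℓ : V →L[ℝ] ℝ) : ∃! u, ∀ v, B u v = ℓ v := by
  refine ⟨hB.continuousLinearEquivOfBilin.symm ((InnerProductSpace.toDual ℝ V).symm ℓ),
    fun v => ?_, fun u hu => ?_⟩
  · rw [← hB.continuousLinearEquivOfBilin_apply, ContinuousLinearEquiv.apply_symm_apply,
      InnerProductSpace.toDual_symm_apply]
  · rw [ContinuousLinearEquiv.eq_symm_apply]
    refine ext_inner_right ℝ fun v => ?_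
    rw [hB.continuousLinearEquivOfBilin_apply, hu, InnerProductSpace.toDual_symm_apply]

end LaxMilgram

/-! ### The graph space of weak derivatives. -/

section Sobolev

variable {a b θ : ℝ}

/-- In this form the condition is the vanishing of continuous linear functionals of `(u, g)`, so
linearity and closedness of the graph can be read off. -/
theorem isWeakPartial_iff_inner {i : Fin 3} {u g : BoxL2 a b θ} : IsWeakPartial i u g ↔
    ∀ (η : ℝ × ℝ × ℝ → ℝ) (hη : ContDiff ℝ ∞ η), HasCompactSupport η → tsupport η ⊆ box a b θ →
      inner ℝ u (memLp_box_of_continuous (continuous_fderiv_coordDir hη i)).toLp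
        + inner ℝ g (memLp_box_of_continuous hη.continuous).toLp = 0 := by
  refine forall₂_congr fun η hη => forall₂_congr fun _ _ => ?_
  rw [inner_L2_eq_of_ae (Filter.EventuallyEq.refl _ _) (MemLp.coeFn_toLp _),
    inner_L2_eq_of_ae (Filter.EventuallyEq.refl _ _) (MemLp.coeFn_toLp _), eq_neg_iff_add_eq_zero]

/-- `H¹` of the box, as the space of tuples `(u, ∂₁u, ∂₂u, ∂₃u)` in `(L²)⁴`. -/
def sobolevGraph (a b θ : ℝ) : Submodule ℝ (PiLp 2 fun _ : Fin 4 => BoxL2 a b θ) where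
  carrier := {Φ | ∀ i : Fin 3, IsWeakPartial i (Φ 0) (Φ i.succ)}
  add_mem' {Φ Ψ} hΦ hΨ i := by
    rw [isWeakPartial_iff_inner]
    intro η h1 h2 h3
    have e1 := isWeakPartial_iff_inner.1 (hΦ i) η h1 h2 h3
    have e2 := isWeakPartial_iff_inner.1 (hΨ i) η h1 h2 h3
    rw [PiLp.add_apply, PiLp.add_apply, inner_add_left, inner_add_left]
    linarith
  zero_mem' i := by
    rw [isWeakPartial_iff_inner]
    intro η h1 h2 h3
    simp
  smul_mem' c Φ hΦ i := by
    rw [isWeakPartial_iff_inner]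
    intro η h1 h2 h3
    have e1 := isWeakPartial_iff_inner.1 (hΦ i) η h1 h2 h3
    rw [PiLp.smul_apply, PiLp.smul_apply, real_inner_smul_left, real_inner_smul_left, ← mul_add,
      e1, mul_zero]

theorem isClosed_sobolevGraph : IsClosed
    (sobolevGraph a b θ : Set (PiLp 2 fun _ : Fin 4 => BoxL2 a b θ)) := by
  have : (sobolevGraph a b θ : Set (PiLp 2 fun _ : Fin 4 => BoxL2 a b θ)) =
      {Φ | ∀ (i : Fin 3) (η : ℝ × ℝ × ℝ → ℝ) (hη : ContDiff ℝ ∞ η), HasCompactSupport η →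
        tsupport η ⊆ box a b θ →
        inner ℝ (Φ 0) (memLp_box_of_continuous (continuous_fderiv_coordDir hη i)).toLp
        + inner ℝ (Φ i.succ) (memLp_box_of_continuous hη.continuous).toLp = 0} := by
    ext Φ
    exact forall_congr' fun i => isWeakPartial_iff_inner
  rw [this]
  simp only [Set.ofPred_forall]
  refine isClosed_iInter fun i => isClosed_iInter fun η => isClosed_iInter fun hη =>
    isClosed_iInter fun _ => isClosed_iInter fun _ => isClosed_eq ?_ continuous_const
  exact ((PiLp.proj 2 (𝕜 := ℝ) (fun _ : Fin 4 => BoxL2 a b θ) 0).continuous.inner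
    continuous_const).add ((PiLp.proj 2 (𝕜 := ℝ) (fun _ : Fin 4 => BoxL2 a b θ)
      i.succ).continuous.inner continuous_const)

instance completeSpace_sobolevGraph : CompleteSpace (sobolevGraph a b θ) :=
  isClosed_sobolevGraph.completeSpace_coe

/-- The components of a tuple `(u, ∂₁u, ∂₂u, ∂₃u)`. -/
def sobolevCoord (a b θ : ℝ) (j : Fin 4) : sobolevGraph a b θ →L[ℝ] BoxL2 a b θ :=
  (PiLp.proj 2 (fun _ : Fin 4 => BoxL2 a b θ) j).comp (sobolevGraph a b θ).subtypeL

theorem isWeakPartial_sobolevCoord (Φ : sobolevGraph a b θ) (i : Fin 3) :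
    IsWeakPartial i (sobolevCoord a b θ 0 Φ) (sobolevCoord a b θ i.succ Φ) := Φ.2 i

theorem memH1_sobolevCoord (Φ : sobolevGraph a b θ) : MemH1 (sobolevCoord a b θ 0 Φ) :=
  fun i => ⟨_, isWeakPartial_sobolevCoord Φ i⟩

/-- Transfers solutions and test functions from `H¹` to the Hilbert space of tuples. -/
theorem MemH1.exists_sobolevCoord_eq {u : BoxL2 a b θ} (hu : MemH1 u) :
    ∃ Φ : sobolevGraph a b θ, sobolevCoord a b θ 0 Φ = u := by
  choose g hg using hu
  exact ⟨⟨WithLp.toLp 2 (Fin.cons u g), fun i => hg i⟩, rfl⟩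

theorem sobolevGraph_norm_sq (Φ : sobolevGraph a b θ) : ‖Φ‖ ^ 2 =
    ‖sobolevCoord a b θ 0 Φ‖ ^ 2 + ‖sobolevCoord a b θ 1 Φ‖ ^ 2 + ‖sobolevCoord a b θ 2 Φ‖ ^ 2
      + ‖sobolevCoord a b θ 3 Φ‖ ^ 2 := by
  rw [Submodule.coe_norm, PiLp.norm_sq_eq_of_L2, Fin.sum_univ_four]
  rfl

theorem weakPartial_sobolevCoord (Φ : sobolevGraph a b θ) :
    weakPartial 0 (sobolevCoord a b θ 0 Φ) = sobolevCoord a b θ 1 Φ ∧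
    weakPartial 1 (sobolevCoord a b θ 0 Φ) = sobolevCoord a b θ 2 Φ ∧
    weakPartial 2 (sobolevCoord a b θ 0 Φ) = sobolevCoord a b θ 3 Φ :=
  ⟨(isWeakPartial_sobolevCoord Φ 0).weakPartial_eq, (isWeakPartial_sobolevCoord Φ 1).weakPartial_eq,
    (isWeakPartial_sobolevCoord Φ 2).weakPartial_eq⟩

end Sobolev

/-! ### Solvability of the shifted problem with bounded coefficients -/

theorem integral_add_add_sub_add {α : Type*} [MeasurableSpace α] {μ : Measure α}
    {f₁ f₂ f₃ f₄ f₅ : α → ℝ} (h₁ : Integrable f₁ μ) (h₂ : Integrable f₂ μ) (h₃ : Integrable f₃ μ)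
    (h₄ : Integrable f₄ μ) (h₅ : Integrable f₅ μ) :
    ∫ x, (f₁ x + f₂ x + f₃ x - f₄ x + f₅ x) ∂μ =
      ∫ x, f₁ x ∂μ + ∫ x, f₂ x ∂μ + ∫ x, f₃ x ∂μ - ∫ x, f₄ x ∂μ + ∫ x, f₅ x ∂μ := by
  have k₁ : Integrable (fun x => f₁ x + f₂ x) μ := h₁.add h₂
  have k₂ : Integrable (fun x => f₁ x + f₂ x + f₃ x) μ := k₁.add h₃
  have k₃ : Integrable (fun x => f₁ x + f₂ x + f₃ x - f₄ x) μ := k₂.sub h₄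
  rw [integral_add k₃ h₅, integral_sub k₂ h₄, integral_add k₁ h₃, integral_add h₁ h₂]

theorem integral_eq_sum_inner {α : Type*} [MeasurableSpace α] {μ : Measure α}
    {d₁ d₂ d₄ q : α → ℝ} {A₁ A₂ A₄ A₅ f₁ f₂ f₃ g₀ g₁ g₂ g₃ : Lp ℝ 2 μ}
    (h₁ : A₁ =ᵐ[μ] fun x => d₁ x * f₁ x) (h₂ : A₂ =ᵐ[μ] fun x => d₂ x * f₂ x)
    (h₄ : A₄ =ᵐ[μ] fun x => d₄ x * f₁ x) (h₅ : A₅ =ᵐ[μ] q) :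
    ∫ x, (d₁ x * f₁ x * g₁ x + d₂ x * f₂ x * g₂ x + f₃ x * g₃ x - d₄ x * f₁ x * g₀ x
      + q x * g₀ x) ∂μ =
    inner ℝ A₁ g₁ + inner ℝ A₂ g₂ + inner ℝ f₃ g₃ - inner ℝ A₄ g₀ + inner ℝ A₅ g₀ := by
  simp only [inner_L2_eq_integral]
  rw [← integral_add_add_sub_add (integrable_L2_mul A₁ g₁) (integrable_L2_mul A₂ g₂)
    (integrable_L2_mul f₃ g₃) (integrable_L2_mul A₄ g₀) (integrable_L2_mul A₅ g₀)]
  refine integral_congr_ae ?_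
  filter_upwards [h₁, h₂, h₄, h₅] with x q₁ q₂ q₄ q₅
  rw [q₁, q₂, q₄, q₅]

theorem integral_sub_eq_inner {α : Type*} [MeasurableSpace α] {μ : Measure α} {m₁ m₂ : α → ℝ}
    (h₁ : MemLp m₁ 2 μ) (h₂ : MemLp m₂ 2 μ) (e₁ e₂ : ℝ) (f₁ f₂ : Lp ℝ 2 μ) :
    ∫ x, (e₂ * m₂ x * f₂ x - e₁ * m₁ x * f₁ x) ∂μ
      = inner ℝ (e₂ • h₂.toLp) f₂ - inner ℝ (e₁ • h₁.toLp) f₁ := by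
  rw [inner_L2_eq_integral, inner_L2_eq_integral,
    ← integral_sub (integrable_L2_mul _ f₂) (integrable_L2_mul _ f₁)]
  refine integral_congr_ae ?_
  filter_upwards [Lp.coeFn_smul e₂ h₂.toLp, Lp.coeFn_smul e₁ h₁.toLp, h₁.coeFn_toLp,
    h₂.coeFn_toLp] with y q1 q2 q3 q4
  rw [q1, q2, Pi.smul_apply, Pi.smul_apply, q3, q4, smul_eq_mul, smul_eq_mul]

/-- Scalar bookkeeping for coercivity: `U, x, y, z` stand for the norms of `u, ∂₁u, ∂₂u, ∂₃u`, `t`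
for that of the left trace, and `p₁, …, p₆` for the terms of the form at `(u, u)`. Drift and trace
each cost `δ/4 * x²`, leaving `δ/2`. The trace enters with coefficient `k + 1`: `k` from the Robin
term, `1` from Young's inequality in the nonlocal term. -/
theorem coercive_lower_bound {δ β C₅ C₄ k C K x y z U t p₁ p₂ p₃ p₄ p₅ p₆ : ℝ} (hδ : 0 < δ)
    (hk : 0 ≤ k) (ht : t ^ 2 ≤ C * U ^ 2 + δ / (4 * (k + 1)) * x ^ 2)
    (h₁ : δ * x ^ 2 ≤ p₁) (h₂ : β * y ^ 2 ≤ p₂) (h₃ : z ^ 2 ≤ p₃) (h₄ : p₄ ≤ C₅ * x * U)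
    (h₅ : -(C₄ * t * U) ≤ p₅) (h₆ : -(k * t ^ 2) ≤ p₆)
    (hK : C₅ ^ 2 / δ + C₄ ^ 2 + (k + 1) * C + 1 ≤ K) :
    min (δ / 2) (min β 1) * (U ^ 2 + x ^ 2 + y ^ 2 + z ^ 2)
      ≤ p₁ + p₂ + p₃ - p₄ + p₅ + p₆ + K * U ^ 2 := by
  set m := min (δ / 2) (min β 1)
  have m1 : m ≤ δ / 2 := min_le_left _ _
  have m2 : m ≤ β := (min_le_right _ _).trans (min_le_left _ _)
  have m3 : m ≤ 1 := (min_le_right _ _).trans (min_le_right _ _)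
  have q1 : C₅ * x * U ≤ δ / 4 * x ^ 2 + C₅ ^ 2 / δ * U ^ 2 := by
    have : δ / 4 * x ^ 2 + C₅ ^ 2 / δ * U ^ 2 - C₅ * x * U = δ * (x / 2 - C₅ / δ * U) ^ 2 := by
      field_simp
      ring
    nlinarith [mul_nonneg hδ.le (sq_nonneg (x / 2 - C₅ / δ * U))]
  have q2 : C₄ * t * U ≤ t ^ 2 + C₄ ^ 2 * U ^ 2 := by
    nlinarith [sq_nonneg (t - C₄ * U), sq_nonneg (t + C₄ * U), sq_nonneg t, sq_nonneg (C₄ * U)]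
  have q3 : (k + 1) * t ^ 2 ≤ (k + 1) * C * U ^ 2 + δ / 4 * x ^ 2 := by
    have h := mul_le_mul_of_nonneg_left ht (by linarith : 0 ≤ k + 1)
    have e : (k + 1) * (C * U ^ 2 + δ / (4 * (k + 1)) * x ^ 2)
        = (k + 1) * C * U ^ 2 + δ / 4 * x ^ 2 := by
      have : k + 1 ≠ 0 := by linarith
      field_simp
    linarith
  have r1 := mul_le_mul_of_nonneg_right m1 (sq_nonneg x)
  have r2 := mul_le_mul_of_nonneg_right m2 (sq_nonneg y)
  have r3 := mul_le_mul_of_nonneg_right m3 (sq_nonneg z)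
  have r4 := mul_le_mul_of_nonneg_right m3 (sq_nonneg U)
  have r5 := mul_le_mul_of_nonneg_right hK (sq_nonneg U)
  nlinarith

set_option maxHeartbeats 2000000 in
/-- For bounded coefficients and an elliptic principal part, the problem with nonlocal term and
Robin condition on the left face is uniquely solvable in `H¹` once the zeroth-order shift is
large, uniformly in the width of the cross section. -/
theorem existsUnique_weakSolution {a b : ℝ} (ha : 0 < a) (hab : a < b) {D₁ D₅ D₄ : ℝ → ℝ}
    {δ C₁ C₅ C₄ : ℝ} (hδ : 0 < δ)
    (hm₁ : AEStronglyMeasurable D₁ (volume.restrict (Ioo a b)))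
    (hm₅ : AEStronglyMeasurable D₅ (volume.restrict (Ioo a b)))
    (hm₄ : AEStronglyMeasurable D₄ (volume.restrict (Ioo a b)))
    (hδ₁ : ∀ s ∈ Ioo a b, δ ≤ D₁ s) (hC₁ : ∀ s ∈ Ioo a b, |D₁ s| ≤ C₁)
    (hC₅ : ∀ s ∈ Ioo a b, |D₅ s| ≤ C₅) (hC₄ : ∀ s ∈ Ioo a b, |D₄ s| ≤ C₄) (κ e₁ e₂ : ℝ) :
    ∃ K₀ : ℝ, 0 < K₀ ∧ ∀ K : ℝ, K₀ ≤ K → ∀ (θ : ℝ) (G : ℝ × ℝ × ℝ → ℝ) (m₁ m₂ : ℝ × ℝ → ℝ),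
      MemLp G 2 (volume.restrict (box a b θ)) → MemLp m₁ 2 (volume.restrict (crossSection θ)) →
      MemLp m₂ 2 (volume.restrict (crossSection θ)) →
      ∃! φ : BoxL2 a b θ, MemH1 φ ∧ ∀ ψ : BoxL2 a b θ, MemH1 ψ →
        (∫ y in box a b θ,
          (D₁ y.1 * weakPartial 0 φ y * weakPartial 0 ψ y
            + 1 / y.1 ^ 2 * weakPartial 1 φ y * weakPartial 1 ψ y
            + weakPartial 2 φ y * weakPartial 2 ψ y
            - D₅ y.1 * weakPartial 0 φ y * ψ y
            + D₄ y.1 * traceLeft φ y.2 * ψ y))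
          + (∫ y' in crossSection θ, κ * traceLeft φ y' * traceLeft ψ y')
          + K * (∫ y in box a b θ, φ y * ψ y)
        = -(∫ y in box a b θ, ψ y * G y)
          + ∫ y' in crossSection θ,
            (e₂ * m₂ y' * traceRight ψ y' - e₁ * m₁ y' * traceLeft ψ y') := by
  have hb : 0 < b := ha.trans hab
  have hs : ((a + b) / 2) ∈ Ioo a b := ⟨by linarith, by linarith⟩
  have hC₄0 : 0 ≤ C₄ := (abs_nonneg _).trans (hC₄ _ hs)
  -- After multiplication by `|κ| + 1`, the derivative's coefficient is `δ / 4`.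
  obtain ⟨C, hC0, hC⟩ := exists_trace_bound hab
    (show 0 < δ / (4 * (|κ| + 1)) by positivity)
  have hone : MemLp (fun _ : ℝ => (1 : ℝ)) 2 (volume.restrict (Ioo a b)) :=
    memLp_Ioo_of_continuous continuous_const
  -- Bounds the norm of the extension constant in `y₁`, through which the nonlocal term acts. It is
  -- free of `θ`, so the shift can be fixed before the cross section.
  set Q : ℝ := Real.sqrt (∫ _ in Ioo a b, (1 : ℝ) ^ 2)
  refine ⟨C₅ ^ 2 / δ + (C₄ * Q) ^ 2 + (|κ| + 1) * C + 1, by positivity,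
    fun K hK θ G m₁ m₂ hG h₁ h₂ => ?_⟩
  have hmp : AEStronglyMeasurable (fun s : ℝ => 1 / s ^ 2) (volume.restrict (Ioo a b)) := by
    refine ContinuousOn.aestronglyMeasurable (fun s hs => ?_) measurableSet_Ioo
    have : s ^ 2 ≠ 0 := pow_ne_zero 2 (ha.trans hs.1).ne'
    exact (continuousAt_const.div (continuousAt_id.pow 2) this).continuousWithinAt
  have hbox {p : ℝ → Prop} (hp : ∀ s ∈ Ioo a b, p s) :
      ∀ᵐ y : ℝ × ℝ × ℝ ∂volume.restrict (box a b θ), p y.1 := by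
    filter_upwards [ae_restrict_mem isOpen_box.measurableSet] with y hy using hp _ hy.1
  have hCp : ∀ s ∈ Ioo a b, |1 / s ^ 2| ≤ 1 / a ^ 2 := fun s hs => by
    rw [abs_of_nonneg (by positivity)]
    exact one_div_le_one_div_of_le (by positivity) (pow_le_pow_left₀ ha.le hs.1.le 2)
  have hδp : ∀ s ∈ Ioo a b, 1 / b ^ 2 ≤ 1 / s ^ 2 := fun s hs => by
    have := ha.trans hs.1
    exact one_div_le_one_div_of_le (by positivity) (pow_le_pow_left₀ this.le hs.2.le 2)
  obtain ⟨M₁, hM₁, -⟩ := exists_mulL2 (aestronglyMeasurable_comp_fst_box (θ := θ) hm₁) (hbox hC₁)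
  obtain ⟨M₅, hM₅, hM₅n⟩ :=
    exists_mulL2 (aestronglyMeasurable_comp_fst_box (θ := θ) hm₅) (hbox hC₅)
  obtain ⟨M₄, hM₄, hM₄n⟩ :=
    exists_mulL2 (aestronglyMeasurable_comp_fst_box (θ := θ) hm₄) (hbox hC₄)
  obtain ⟨Mp, hMp, -⟩ := exists_mulL2 (aestronglyMeasurable_comp_fst_box (θ := θ) hmp) (hbox hCp)
  obtain ⟨L₀, L₁, R₀, R₁, htr⟩ := exists_trace_operators hab θ
  let P := sobolevCoord a b θ
  let T := extend θ hone
  -- On tuples the traces are bounded linear operators, so every boundary term is a bounded form or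
  -- functional.
  let tL : sobolevGraph a b θ →L[ℝ] SectionL2 θ := L₀.comp (P 0) + L₁.comp (P 1)
  let tR : sobolevGraph a b θ →L[ℝ] SectionL2 θ := R₀.comp (P 0) + R₁.comp (P 1)
  have htL (Φ : sobolevGraph a b θ) : traceLeft (P 0 Φ) = tL Φ :=
    (htr _ _ (isWeakPartial_sobolevCoord Φ 0)).1
  have htR (Φ : sobolevGraph a b θ) : traceRight (P 0 Φ) = tR Φ :=
    (htr _ _ (isWeakPartial_sobolevCoord Φ 0)).2
  let J := innerBilin (BoxL2 a b θ)
  let J' := innerBilin (SectionL2 θ)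
  let B : sobolevGraph a b θ →L[ℝ] sobolevGraph a b θ →L[ℝ] ℝ :=
    J.bilinearComp (M₁.comp (P 1)) (P 1) + J.bilinearComp (Mp.comp (P 2)) (P 2)
      + J.bilinearComp (P 3) (P 3) - J.bilinearComp (M₅.comp (P 1)) (P 0)
      + J.bilinearComp (M₄.comp (T.comp tL)) (P 0) + κ • J'.bilinearComp tL tL
      + K • J.bilinearComp (P 0) (P 0)
  have hB (Φ Ψ : sobolevGraph a b θ) : B Φ Ψ =
      inner ℝ (M₁ (P 1 Φ)) (P 1 Ψ) + inner ℝ (Mp (P 2 Φ)) (P 2 Ψ) + inner ℝ (P 3 Φ) (P 3 Ψ)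
        - inner ℝ (M₅ (P 1 Φ)) (P 0 Ψ) + inner ℝ (M₄ (T (tL Φ))) (P 0 Ψ)
        + κ * inner ℝ (tL Φ) (tL Ψ) + K * inner ℝ (P 0 Φ) (P 0 Ψ) := rfl
  have hcoer : IsCoercive B := by
    refine ⟨min (δ / 2) (min (1 / b ^ 2) 1), by positivity, fun Φ => ?_⟩
    have hT : ‖T (tL Φ)‖ ≤ Q * ‖tL Φ‖ := T.le_of_opNorm_le (norm_extend_le hone) _
    rw [mul_assoc, ← sq, sobolevGraph_norm_sq, hB, real_inner_self_eq_norm_sq (P 0 Φ),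
      real_inner_self_eq_norm_sq (tL Φ), real_inner_self_eq_norm_sq (P 3 Φ)]
    refine coercive_lower_bound (t := ‖tL Φ‖) hδ (abs_nonneg κ) ?_
      (le_inner_of_ae_le (hM₁ _) (hbox hδ₁)) (le_inner_of_ae_le (hMp _) (hbox hδp)) le_rfl ?_ ?_
      ?_ hK
    · rw [← htL]
      exact hC θ _ _ (isWeakPartial_sobolevCoord Φ 0)
    · refine (real_inner_le_norm _ _).trans ?_
      gcongr
      exact hM₅n _
    · refine neg_le_of_abs_le ((abs_real_inner_le_norm _ _).trans ?_)
      gcongr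
      refine (hM₄n _).trans ?_
      rw [mul_assoc]
      gcongr
    · rw [← neg_mul]
      gcongr
      exact neg_abs_le κ
  let ℓ : sobolevGraph a b θ →L[ℝ] ℝ :=
    -(J hG.toLp).comp (P 0) + ((J' (e₂ • h₂.toLp)).comp tR - (J' (e₁ • h₁.toLp)).comp tL)
  have hℓ (Ψ : sobolevGraph a b θ) : ℓ Ψ = -inner ℝ hG.toLp (P 0 Ψ)
      + (inner ℝ (e₂ • h₂.toLp) (tR Ψ) - inner ℝ (e₁ • h₁.toLp) (tL Ψ)) := rfl
  have hBint (Φ Ψ : sobolevGraph a b θ) :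
      (∫ y in box a b θ,
          (D₁ y.1 * weakPartial 0 (P 0 Φ) y * weakPartial 0 (P 0 Ψ) y
            + 1 / y.1 ^ 2 * weakPartial 1 (P 0 Φ) y * weakPartial 1 (P 0 Ψ) y
            + weakPartial 2 (P 0 Φ) y * weakPartial 2 (P 0 Ψ) y
            - D₅ y.1 * weakPartial 0 (P 0 Φ) y * P 0 Ψ y
            + D₄ y.1 * traceLeft (P 0 Φ) y.2 * P 0 Ψ y))
          + (∫ y' in crossSection θ, κ * traceLeft (P 0 Φ) y' * traceLeft (P 0 Ψ) y')
          + K * (∫ y in box a b θ, P 0 Φ y * P 0 Ψ y) = B Φ Ψ := by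
    obtain ⟨w1, w2, w3⟩ := weakPartial_sobolevCoord Φ
    obtain ⟨v1, v2, v3⟩ := weakPartial_sobolevCoord Ψ
    have hT : M₄ (T (tL Φ)) =ᵐ[volume.restrict (box a b θ)]
        fun y => D₄ y.1 * tL Φ y.2 := by
      filter_upwards [hM₄ (T (tL Φ)), extend_ae hone (tL Φ)] with y q1 q2
      rw [q1, q2, one_mul]
    rw [hB, htL, htL, w1, w2, w3, v1, v2, v3,
      integral_eq_sum_inner (hM₁ (P 1 Φ)) (hMp (P 2 Φ)) (hM₅ (P 1 Φ)) hT,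
      ← inner_L2_eq_integral (P 0 Φ)]
    simp only [mul_assoc κ, integral_const_mul]
    rw [← inner_L2_eq_integral (tL Φ)]
  have hℓint (Ψ : sobolevGraph a b θ) : -(∫ y in box a b θ, P 0 Ψ y * G y)
      + ∫ y' in crossSection θ,
        (e₂ * m₂ y' * traceRight (P 0 Ψ) y' - e₁ * m₁ y' * traceLeft (P 0 Ψ) y') = ℓ Ψ := by
    rw [hℓ, htL, htR, real_inner_comm,
      inner_L2_eq_of_ae (Filter.EventuallyEq.refl _ _) hG.coeFn_toLp]
    rw [integral_sub_eq_inner h₁ h₂]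
  obtain ⟨Φ, hΦ, huniq⟩ := hcoer.existsUnique_forall_eq ℓ
  refine ⟨P 0 Φ, ⟨memH1_sobolevCoord Φ, fun ψ hψ => ?_⟩, fun φ hφ => ?_⟩
  · obtain ⟨Ψ, rfl⟩ := hψ.exists_sobolevCoord_eq
    exact (hBint Φ Ψ).trans ((hΦ Ψ).trans (hℓint Ψ).symm)
  -- Another weak solution lifts to a tuple solving the same abstract equation, so abstract
  -- uniqueness applies.
  · obtain ⟨Φ', rfl⟩ := hφ.1.exists_sobolevCoord_eq
    rw [huniq Φ' fun Ψ => (hBint Φ' Ψ).symm.trans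
      ((hφ.2 _ (memH1_sobolevCoord Ψ)).trans (hℓint Ψ))]

/-! ### The coefficients of the background solution -/

/-- The background is controlled only on a closed interval, so `deriv` is uninformative at the
endpoints. It agrees with the continuous `derivWithin` in the interior, which suffices almost
everywhere. -/
theorem aestronglyMeasurable_and_bounded_of_eqOn {a b : ℝ} {f F : ℝ → ℝ}
    (hF : ContinuousOn F (Icc a b)) (hfF : EqOn f F (Ioo a b)) :
    AEStronglyMeasurable f (volume.restrict (Ioo a b)) ∧ ∃ C, ∀ s ∈ Ioo a b, |f s| ≤ C := by
  obtain ⟨C, hC⟩ := isCompact_Icc.exists_bound_of_continuousOn hF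
  refine ⟨((hF.mono Ioo_subset_Icc_self).congr hfF).aestronglyMeasurable measurableSet_Ioo,
    C, fun s hs => ?_⟩
  rw [hfF hs]
  exact hC s (Ioo_subset_Icc_self hs)

theorem deriv_eqOn_derivWithin_Icc {a b : ℝ} (f : ℝ → ℝ) :
    EqOn (deriv f) (derivWithin f (Icc a b)) (Ioo a b) := fun _ hs =>
  (derivWithin_of_mem_nhds (Icc_mem_nhds hs.1 hs.2)).symm

namespace TransonicShock

variable (S : TransonicShock)

theorem pos_of_mem_Icc {r : ℝ} (hr : r ∈ Icc S.rs S.r2) : 0 < r :=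
  (S.r1_pos.trans S.r1_lt_rs).trans_le hr.1

theorem kp_pos : 0 < S.kp := S.km_pos.trans S.entropy

theorem soundSpeedSq_pos {r : ℝ} (hr : r ∈ Icc S.rs S.r2) :
    0 < soundSpeedSq S.γ S.kp (S.ρp r) := (sq_nonneg _).trans_lt (S.subsonic r hr)

/-- Ellipticity of the problem is exactly subsonicity of the downstream flow. -/
theorem d1_pos {r : ℝ} (hr : r ∈ Icc S.rs S.r2) : 0 < S.d1 r :=
  sub_pos.2 ((div_lt_one (S.soundSpeedSq_pos hr)).2 (S.subsonic r hr))

theorem contDiffOn_machSq : ContDiffOn ℝ ∞ S.machSq (Icc S.rs S.r2) :=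
  (S.downstream.smooth_velocity.pow 2).div
    (contDiffOn_const.mul (S.downstream.smooth_density.rpow_const_of_ne fun r hr =>
      (S.downstream.density_pos r hr).ne')) fun _ hr => (S.soundSpeedSq_pos hr).ne'

theorem contDiffOn_d1 : ContDiffOn ℝ ∞ S.d1 (Icc S.rs S.r2) :=
  contDiffOn_const.sub S.contDiffOn_machSq

theorem contDiffOn_d2 : ContDiffOn ℝ ∞ S.d2 (Icc S.rs S.r2) :=
  (S.contDiffOn_machSq.mul (contDiffOn_const.add (contDiffOn_const.mul S.contDiffOn_machSq))).div
    (contDiffOn_id.mul S.contDiffOn_d1)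
    fun _ hr => (mul_pos (S.pos_of_mem_Icc hr) (S.d1_pos hr)).ne'

theorem contDiffOn_d3 : ContDiffOn ℝ ∞ S.d3 (Icc S.rs S.r2) :=
  contDiffOn_const.mul ((contDiffOn_const.sub
    ((S.downstream.smooth_velocity.pow 2).div_const 2)).div
      (contDiffOn_const.mul S.downstream.smooth_velocity) fun r hr =>
        (mul_pos (mul_pos (zero_lt_one.trans S.one_lt_γ) S.kp_pos)
          (S.downstream.velocity_pos r hr)).ne')

theorem continuousOn_inv_add_d2 :
    ContinuousOn (fun r => 1 / r + S.d2 r) (Icc S.rs S.r2) :=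
  (continuousOn_const.div continuousOn_id fun _ hr => (S.pos_of_mem_Icc hr).ne').add
    S.contDiffOn_d2.continuousOn

theorem continuousOn_derivWithin {f : ℝ → ℝ} (hf : ContDiffOn ℝ ∞ f (Icc S.rs S.r2)) :
    ContinuousOn (derivWithin f (Icc S.rs S.r2)) (Icc S.rs S.r2) :=
  hf.continuousOn_derivWithin (uniqueDiffOn_Icc S.rs_lt_r2) (by simp)

theorem d4_bounded (c : ℝ) :
    AEStronglyMeasurable (fun r => c * S.d4 r) (volume.restrict (Ioo S.rs S.r2)) ∧
      ∃ C, ∀ r ∈ Ioo S.rs S.r2, |c * S.d4 r| ≤ C :=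
  aestronglyMeasurable_and_bounded_of_eqOn
    (F := fun r => c * (S.d1 r * derivWithin S.d3 (Icc S.rs S.r2) r
      + (1 / r + S.d2 r) * S.d3 r))
    (continuousOn_const.mul
      ((S.contDiffOn_d1.continuousOn.mul (S.continuousOn_derivWithin S.contDiffOn_d3)).add
        (S.continuousOn_inv_add_d2.mul S.contDiffOn_d3.continuousOn)))
    fun r hr => by simp only [d4, deriv_eqOn_derivWithin_Icc S.d3 hr]

theorem d5_bounded : AEStronglyMeasurable S.d5 (volume.restrict (Ioo S.rs S.r2)) ∧
    ∃ C, ∀ r ∈ Ioo S.rs S.r2, |S.d5 r| ≤ C :=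
  aestronglyMeasurable_and_bounded_of_eqOn
    (F := fun r => 1 / r + S.d2 r - derivWithin S.d1 (Icc S.rs S.r2) r)
    (S.continuousOn_inv_add_d2.sub (S.continuousOn_derivWithin S.contDiffOn_d1))
    fun r hr => by simp only [d5, deriv_eqOn_derivWithin_Icc S.d1 hr]

theorem exists_pos_le_d1 : ∃ δ, 0 < δ ∧ ∀ r ∈ Ioo S.rs S.r2, δ ≤ S.d1 r := by
  obtain ⟨r₀, hr₀, hmin⟩ := isCompact_Icc.exists_isMinOn (nonempty_Icc.2 S.rs_lt_r2.le)
    S.contDiffOn_d1.continuousOn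
  exact ⟨S.d1 r₀, S.d1_pos hr₀, fun r hr => hmin (Ioo_subset_Icc_self hr)⟩

end TransonicShock

end

theorem lemma3p1 (S : TransonicShock) :
    ∃ K₀ : ℝ, 0 < K₀ ∧ ∀ K : ℝ, K₀ ≤ K →
      ∀ θ₀ : ℝ, 0 < θ₀ → θ₀ < Real.pi / 2 →
      ∀ (G₅ : ℝ × ℝ × ℝ → ℝ) (m₁ m₂ : ℝ × ℝ → ℝ),
        MemLp G₅ 2 (volume.restrict (box S.rs S.r2 θ₀)) →
        MemLp m₁ 2 (volume.restrict (crossSection θ₀)) →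
        MemLp m₂ 2 (volume.restrict (crossSection θ₀)) →
        ∃! φ : BoxL2 S.rs S.r2 θ₀, S.IsWeakSolution K G₅ m₁ m₂ φ := by
  obtain ⟨δ, hδ, hδ₁⟩ := S.exists_pos_le_d1
  obtain ⟨hm₁, C₁, hC₁⟩ := aestronglyMeasurable_and_bounded_of_eqOn
    S.contDiffOn_d1.continuousOn fun _ _ => rfl
  obtain ⟨hm₅, C₅, hC₅⟩ := S.d5_bounded
  obtain ⟨hm₄, C₄, hC₄⟩ := S.d4_bounded (S.a0 * S.a1)
  -- The factor `a0 * a1` is absorbed into the nonlocal coefficient. The Robin coefficient enters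
  -- the shift only through its absolute value, so the sign of `a4` plays no role.
  obtain ⟨K₀, hK₀, h⟩ := existsUnique_weakSolution (S.r1_pos.trans S.r1_lt_rs) S.rs_lt_r2 hδ
    hm₁ hm₅ hm₄ hδ₁ hC₁ hC₅ hC₄ (S.d1 S.rs * S.a4) (S.d1 S.rs) (S.d1 S.r2)
  exact ⟨K₀, hK₀, fun K hK θ₀ _ _ => h K hK θ₀⟩
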